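/- A *constraint* of arity $k$ is a function $f:\{0,1\}^k\to\mathbb{R}^{\ge 0}$; it is presented by the series of its $2^k$ values in lexicographic order of the arguments. Let $\mathcal{U}$ be the set of all unary constraints, $EQ=(1,0,0,1)$ and $XOR=(0,1,1,0)$. Let $\mathcal{ED}$ be the set of all constraints that are products of unary constraints $u(x_i)$, equalities $EQ(x_i,x_j)$ and disequalities $XOR(x_i,x_j)$. Let $\mathcal{AF}$ be the set of all constraints of the form $g(x_1,\dots,x_k)\prod_{j\ne i}R_j(x_i,x_j)$ for some fixed index $i\in[k]$, where $g(x_1,\dots,x_k)=\prod_{l}u_l(x_l)$ is a product of unary constraints applied to different variables and every $R_j\subseteq\{0,1\}^2$ is an affine relation, i.e. the solution set of a system of linear equations over $GF(2)$, viewed as a $\{0,1\}$-valued function. For a set $\mathcal{F}$ of constraints, $\mathrm{MAX\text{-}PROD\text{-}CSP}^*(\mathcal{F})$ is the following maximization problem. An instance consists of a number $n$ of Boolean variables $x_1,\dots,x_n$ and a finite set $H$ of elements $\langle h,(x_{i_1},\dots,x_{i_k})\rangle$ with $h\in\mathcal{F}\cup\mathcal{U}$ of arity $k$ and $i_1,\dots,i_k\in[n]$;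 a solution is a truth assignment $\sigma$ to $x_1,\dots,x_n$; the measure to be maximized is $\prod_{\langle h,(x_{i_1},\dots,x_{i_k})\rangle\in H}h(\sigma(x_{i_1}),\dots,\sigma(x_{i_k}))$. Algorithms are deterministic programs of a real random access machine (equivalently, Blum–Shub–Smale machines): real numbers are stored exactly, and each arithmetic operation on or comparison of reals takes one step. The size of an instance counts every table entry as $1$ and writes $n$, the arities and the indices in unary. A maximization problem is in $\mathrm{NPO}$ if (1) its instances, and the solutions of a given instance, can be recognized in polynomial time, (2) the size of solutions is polynomially bounded in the size of the instance, and (3) the measure can be computed in polynomial time; it is in $\mathrm{PO}$ if in addition a deterministic algorithm returns an optimal solution of every instance in time polynomial in the size of the instance. **Proposition.** Let $\mathcal{F}$ be any set of constraints, finite or infinite, with $\mathcal{F}\subseteq\mathcal{AF}$ or $\mathcal{F}\subseteq\mathcal{ED}$. Then a deterministic polynomial-time algorithm returns an optimal solution of every instance of $\mathrm{MAX\text{-}PROD\text{-}CSP}^*(\mathcal{F})$; moreover, solutions of a given instance are recognizable in polynomial time, solutions are polynomially bounded, and the measure is computable in polynomial time. If furthermore $\mathcal{F}$ is finite or, more generally,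 membership of a constraint in $\mathcal{F}\cup\mathcal{U}$ can be decided in polynomial time (so that instances can be recognized at all), then $\mathrm{MAX\text{-}PROD\text{-}CSP}^*(\mathcal{F})$ belongs to $\mathrm{PO}$. -/

import Mathlib

open scoped NNReal

noncomputable section

/-! ## Constraints and special sets of constraints -/

/-- A nonnegative-real-weighted Boolean constraint `f : {0,1}^k → ℝ≥0`, together with its arity. -/
structure Constraint where
  arity : ℕ
  val : (Fin arity → Bool) → ℝ≥0

namespace Constraint

/-- The set of all unary constraints. -/
def unary : Set Constraint := {f | f.arity = 1}

/-- A bit as an element of the field with two elements. -/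
def bit (b : Bool) : ZMod 2 := if b then 1 else 0

/-- A relation is affine if it is the solution set of a system of linear equations over `GF(2)`. -/
def IsAffine {k : ℕ} (R : Set (Fin k → Bool)) : Prop :=
  ∃ (m : ℕ) (A : Matrix (Fin m) (Fin k) (ZMod 2)) (b : Fin m → ZMod 2),
    R = {x | A.mulVec (fun i => bit (x i)) = b}

/-- A degenerate function: a product of unary constraints applied to different variables. -/
def IsDegenerate {k : ℕ} (g : (Fin k → Bool) → ℝ≥0) : Prop :=
  ∃ u : Fin k → Bool → ℝ≥0, ∀ x, g x = ∏ i, u i (x i)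

/-- The set `AF`: constraints of the form `g(x₁,…,x_k) ∏_{j ≠ i} R_j(x_i, x_j)` with `i` a fixed
index, `g` degenerate and every `R_j` an affine binary relation (as a `0`-`1`-valued function). -/
def AF : Set Constraint :=
  {f | ∃ (i : Fin f.arity) (g : (Fin f.arity → Bool) → ℝ≥0)
      (R : Fin f.arity → Set (Fin 2 → Bool)),
    IsDegenerate g ∧ (∀ j, IsAffine (R j)) ∧
    ∀ x, f.val x = g x * ∏ j ∈ Finset.univ.erase i, (R j).indicator 1 ![x i, x j]}

/-- The possible factors of the constraints in `ED`, over `k` variables. -/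
inductive EDFactor (k : ℕ) where
  | unary (u : Bool → ℝ≥0) (i : Fin k)
  | eq (i j : Fin k)
  | xor (i j : Fin k)

/-- Value of a factor on an assignment; `EQ = (1,0,0,1)` and `XOR = (0,1,1,0)`. -/
def EDFactor.eval {k : ℕ} (x : Fin k → Bool) : EDFactor k → ℝ≥0
  | .unary u i => u (x i)
  | .eq i j => if x i = x j then 1 else 0
  | .xor i j => if x i = x j then 0 else 1

/-- The set `ED`: products of unary constraints, equalities and disequalities. -/
def ED : Set Constraint :=
  {f | ∃ L : List (EDFactor f.arity), ∀ x, f.val x = (L.map (EDFactor.eval x)).prod}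

end Constraint

/-! ## The machine model: a real random access machine with unit cost

Real numbers are handled exactly and at unit cost, as in the Blum–Shub–Smale model: a program may
contain real constants, and it may add, subtract, multiply, divide and compare real numbers. Natural
numbers serve for counting and indexing; on them only addition, (truncated) subtraction and
comparison are available, so that no number of superpolynomial length arises in polynomial time. -/

/-- The data that machines read and write: a finite sequence of naturals and one of reals. -/
structure Word where
  nats : List ℕ
  reals : List ℝ

namespace Word

/-- Size of a word: every real counts `1` and naturals are counted in unary. -/
def size (w : Word) : ℕ := w.nats.length + w.nats.sum + w.reals.length

/-- Two words written as one; the two lengths in front make the pairing unambiguous. -/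
def pair (w v : Word) : Word :=
  ⟨w.nats.length :: w.reals.length :: (w.nats ++ v.nats), w.reals ++ v.reals⟩

/-- The answer "yes". -/
def yes : Word := ⟨[1], []⟩

/-- The answer "no". -/
def no : Word := ⟨[0], []⟩

theorem pair_injective {w v w' v' : Word} (h : pair w v = pair w' v') : w = w' ∧ v = v' := by
  obtain ⟨a, b⟩ := w
  obtain ⟨c, d⟩ := v
  obtain ⟨a', b'⟩ := w'
  obtain ⟨c', d'⟩ := v'
  simp only [pair, Word.mk.injEq, List.cons.injEq] at h
  obtain ⟨⟨h1, h2, h3⟩, h4⟩ := h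
  obtain ⟨rfl, rfl⟩ := List.append_inj h3 h1
  obtain ⟨rfl, rfl⟩ := List.append_inj h4 h2
  exact ⟨rfl, rfl⟩

end Word

namespace RealRAM

/-- Memory: registers and dynamic arrays, for naturals and for reals. A program mentions only
finitely many of them. -/
structure State where
  natReg : ℕ → ℕ
  realReg : ℕ → ℝ
  natArr : ℕ → List ℕ
  realArr : ℕ → List ℝ

/-- Expressions for naturals: constants, registers, array lengths, array entries, `+`, `-`. -/
inductive NatExp where
  | const (c : ℕ)
  | reg (r : ℕ)
  | natLen (a : ℕ)
  | realLen (a : ℕ)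
  | get (a : ℕ) (i : NatExp)
  | add (e₁ e₂ : NatExp)
  | sub (e₁ e₂ : NatExp)

/-- Value of an expression; an array entry outside the array reads as `0`. -/
def NatExp.eval (s : State) : NatExp → ℕ
  | .const c => c
  | .reg r => s.natReg r
  | .natLen a => (s.natArr a).length
  | .realLen a => (s.realArr a).length
  | .get a i => (s.natArr a).getD (i.eval s) 0
  | .add e₁ e₂ => e₁.eval s + e₂.eval s
  | .sub e₁ e₂ => e₁.eval s - e₂.eval s

/-- Expressions for reals: constants, registers, array entries and the field operations. -/
inductive RealExp where
  | const (c : ℝ)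
  | reg (r : ℕ)
  | get (a : ℕ) (i : NatExp)
  | add (e₁ e₂ : RealExp)
  | sub (e₁ e₂ : RealExp)
  | mul (e₁ e₂ : RealExp)
  | div (e₁ e₂ : RealExp)

/-- Value of an expression; an array entry outside the array reads as `0`. -/
def RealExp.eval (s : State) : RealExp → ℝ
  | .const c => c
  | .reg r => s.realReg r
  | .get a i => (s.realArr a).getD (i.eval s) 0
  | .add e₁ e₂ => e₁.eval s + e₂.eval s
  | .sub e₁ e₂ => e₁.eval s - e₂.eval s
  | .mul e₁ e₂ => e₁.eval s * e₂.eval s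
  | .div e₁ e₂ => e₁.eval s / e₂.eval s

/-- Branching conditions. -/
inductive Test where
  | natLe (e₁ e₂ : NatExp)
  | realLe (e₁ e₂ : RealExp)
  | not (b : Test)
  | and (b₁ b₂ : Test)

def Test.Holds (s : State) : Test → Prop
  | .natLe e₁ e₂ => e₁.eval s ≤ e₂.eval s
  | .realLe e₁ e₂ => e₁.eval s ≤ e₂.eval s
  | .not b => ¬ b.Holds s
  | .and b₁ b₂ => b₁.Holds s ∧ b₂.Holds s

/-- Elementary instructions. -/
inductive Instr where
  | setNat (r : ℕ) (e : NatExp)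
  | setReal (r : ℕ) (e : RealExp)
  | clearNat (a : ℕ)
  | clearReal (a : ℕ)
  | pushNat (a : ℕ) (e : NatExp)
  | pushReal (a : ℕ) (e : RealExp)
  | popNat (a : ℕ)
  | popReal (a : ℕ)
  | writeNat (a : ℕ) (i e : NatExp)
  | writeReal (a : ℕ) (i : NatExp) (e : RealExp)

/-- Effect of an instruction. Arrays grow and shrink at their right end; writing outside an array
has no effect. -/
def Instr.exec (s : State) : Instr → State
  | .setNat r e => { s with natReg := Function.update s.natReg r (e.eval s) }
  | .setReal r e => { s with realReg := Function.update s.realReg r (e.eval s) }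
  | .clearNat a => { s with natArr := Function.update s.natArr a [] }
  | .clearReal a => { s with realArr := Function.update s.realArr a [] }
  | .pushNat a e => { s with natArr := Function.update s.natArr a (s.natArr a ++ [e.eval s]) }
  | .pushReal a e => { s with realArr := Function.update s.realArr a (s.realArr a ++ [e.eval s]) }
  | .popNat a => { s with natArr := Function.update s.natArr a (s.natArr a).dropLast }
  | .popReal a => { s with realArr := Function.update s.realArr a (s.realArr a).dropLast }
  | .writeNat a i e =>
      { s with natArr := Function.update s.natArr a ((s.natArr a).set (i.eval s) (e.eval s)) }
  | .writeReal a i e =>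
      { s with realArr := Function.update s.realArr a ((s.realArr a).set (i.eval s) (e.eval s)) }

/-- Deterministic programs. -/
inductive Prog where
  | instr (a : Instr)
  | seq (c d : Prog)
  | ite (b : Test) (c d : Prog)
  | loop (b : Test) (c : Prog)

/-- `Exec c s s' t`: the program `c`, started in state `s`, halts in state `s'` after `t` steps,
where every execution of an instruction and every evaluation of a test counts as one step. -/
inductive Exec : Prog → State → State → ℕ → Prop
  | instr (a : Instr) (s : State) : Exec (.instr a) s (a.exec s) 1
  | seq {c d : Prog} {s s' s'' : State} {t t' : ℕ} :
      Exec c s s' t → Exec d s' s'' t' → Exec (.seq c d) s s'' (t + t')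
  | iteTrue {b : Test} {c d : Prog} {s s' : State} {t : ℕ} :
      b.Holds s → Exec c s s' t → Exec (.ite b c d) s s' (t + 1)
  | iteFalse {b : Test} {c d : Prog} {s s' : State} {t : ℕ} :
      ¬ b.Holds s → Exec d s s' t → Exec (.ite b c d) s s' (t + 1)
  | loopTrue {b : Test} {c : Prog} {s s' s'' : State} {t t' : ℕ} :
      b.Holds s → Exec c s s' t → Exec (.loop b c) s' s'' t' →
      Exec (.loop b c) s s'' (t + t' + 1)
  | loopFalse {b : Test} {c : Prog} {s : State} :
      ¬ b.Holds s → Exec (.loop b c) s s 1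

/-- The initial state on input `w`: the input stands in the arrays number `0`. -/
def State.init (w : Word) : State where
  natReg := fun _ => 0
  realReg := fun _ => 0
  natArr := fun a => if a = 0 then w.nats else []
  realArr := fun a => if a = 0 then w.reals else []

/-- The output is the content of the arrays number `0`. -/
def State.output (s : State) : Word := ⟨s.natArr 0, s.realArr 0⟩

/-- On input `w` the program `c` halts within `T` steps with output `v`. -/
def Prog.Yields (c : Prog) (w v : Word) (T : ℕ) : Prop :=
  ∃ (s : State) (t : ℕ), Exec c (State.init w) s t ∧ t ≤ T ∧ s.output = v

/-- Among the words in `D`, membership in `L` can be decided in polynomial time. -/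
def PolyDecidableOn (D L : Set Word) : Prop :=
  ∃ (c : Prog) (p : Polynomial ℕ), ∀ w ∈ D,
    (w ∈ L → c.Yields w Word.yes (p.eval w.size)) ∧
    (w ∉ L → c.Yields w Word.no (p.eval w.size))

end RealRAM

/-! ## Maximization problems and the class `PO` -/

/-- A maximization problem, with the encodings of its instances and of its solutions. -/
structure MaxProblem where
  Inst : Type
  Sol : Inst → Type
  measure : (x : Inst) → Sol x → ℝ≥0
  encInst : Inst → Word
  encSol : (x : Inst) → Sol x → Word
  encInst_injective : Function.Injective encInst
  encSol_injective : ∀ x, Function.Injective (encSol x)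

namespace MaxProblem

open RealRAM

variable (P : MaxProblem)

/-- Input instances can be recognized in polynomial time. -/
def InstancesRecognizable : Prop :=
  PolyDecidableOn Set.univ (Set.range P.encInst)

/-- Solutions of a given instance can be recognized in polynomial time. -/
def SolutionsRecognizable : Prop :=
  PolyDecidableOn {w | ∃ (x : P.Inst) (v : Word), w = Word.pair (P.encInst x) v}
    {w | ∃ (x : P.Inst) (y : P.Sol x), w = Word.pair (P.encInst x) (P.encSol x y)}

/-- Solutions are polynomially bounded in the size of the instance. -/
def SolutionsBounded : Prop :=
  ∃ p : Polynomial ℕ, ∀ (x : P.Inst) (y : P.Sol x),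
    (P.encSol x y).size ≤ p.eval (P.encInst x).size

/-- The measure function can be computed in polynomial time. -/
def MeasureComputable : Prop :=
  ∃ (c : Prog) (p : Polynomial ℕ), ∀ (x : P.Inst) (y : P.Sol x),
    c.Yields (Word.pair (P.encInst x) (P.encSol x y)) ⟨[], [(P.measure x y : ℝ)]⟩
      (p.eval (Word.pair (P.encInst x) (P.encSol x y)).size)

/-- A solution of maximum measure. -/
def IsOptimal (x : P.Inst) (y : P.Sol x) : Prop := ∀ y' : P.Sol x, P.measure x y' ≤ P.measure x y

/-- A deterministic program returns, for every instance, an optimal solution in polynomial time. -/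
def OptimumComputable : Prop :=
  ∃ (c : Prog) (p : Polynomial ℕ), ∀ x : P.Inst, ∃ y : P.Sol x,
    P.IsOptimal x y ∧ c.Yields (P.encInst x) (P.encSol x y) (p.eval (P.encInst x).size)

/-- The class `NPO`. -/
def InNPO : Prop :=
  P.InstancesRecognizable ∧ P.SolutionsRecognizable ∧ P.SolutionsBounded ∧ P.MeasureComputable

/-- The class `PO`. -/
def InPO : Prop := P.InNPO ∧ P.OptimumComputable

end MaxProblem

/-! ## The problems `MAX-PROD-CSP` -/

namespace Constraint

/-- The `m`-th element of `{0,1}^k` in lexicographic order, for `m < 2^k`. -/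
def lexTuple (k m : ℕ) : Fin k → Bool := fun i => m.testBit (k - 1 - i)

/-- The series of output values of a constraint, in lexicographic order of the arguments. -/
def table (f : Constraint) : List ℝ :=
  List.ofFn fun m : Fin (2 ^ f.arity) => (f.val (lexTuple f.arity m) : ℝ)

/-- A constraint as machine data. -/
def enc (f : Constraint) : Word := ⟨[f.arity], f.table⟩

/-- Membership of a given constraint in the set `F` can be decided in polynomial time. -/
def Recognizable (F : Set Constraint) : Prop :=
  RealRAM.PolyDecidableOn Set.univ (enc '' F)

theorem lexTuple_surjective (k : ℕ) (x : Fin k → Bool) : ∃ m : Fin (2 ^ k), lexTuple k m = x := by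
  refine ⟨⟨Nat.ofBits fun i => x i.rev, Nat.ofBits_lt_two_pow _⟩, ?_⟩
  funext i
  have hi : k - 1 - (i : ℕ) < k := by omega
  simp only [lexTuple]
  rw [Nat.testBit_ofBits_lt _ _ hi]
  congr 1
  ext
  simp only [Fin.val_rev]
  omega

theorem table_length (f : Constraint) : f.table.length = 2 ^ f.arity := by simp [table]

theorem val_eq_of_table_eq {k : ℕ} {u v : (Fin k → Bool) → ℝ≥0}
    (h : table ⟨k, u⟩ = table ⟨k, v⟩) : u = v := by
  funext x
  obtain ⟨m, rfl⟩ := lexTuple_surjective k x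
  have := congrFun (List.ofFn_injective h) m
  exact NNReal.coe_injective this

end Constraint

/-- An element `⟨h, (x_{i₁},…,x_{i_k})⟩`: a constraint applied to some of the variables
`x₁,…,x_n`, which are indexed here by `0,…,n-1`. -/
structure Application (n : ℕ) where
  con : Constraint
  vars : Fin con.arity → Fin n

namespace Application

variable {n : ℕ}

/-- Value of an applied constraint under a truth assignment. -/
def value (a : Application n) (σ : Fin n → Bool) : ℝ≥0 := a.con.val fun i => σ (a.vars i)

/-- The natural numbers that describe an application: arity and indices of the variables. -/
def nats (a : Application n) : List ℕ := a.con.arity :: List.ofFn fun i => (a.vars i : ℕ)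

theorem flatMap_inj : ∀ L L' : List (Application n), L.flatMap nats = L'.flatMap nats →
    L.flatMap (fun a => a.con.table) = L'.flatMap (fun a => a.con.table) → L = L'
  | [], [], _, _ => rfl
  | [], _ :: _, h, _ => by simp [nats] at h
  | _ :: _, [], h, _ => by simp [nats] at h
  | ⟨⟨k, f⟩, v⟩ :: L, ⟨⟨k', f'⟩, v'⟩ :: L', h, h' => by
      simp only [List.flatMap_cons, nats, List.cons_append, List.cons.injEq] at h h'
      obtain ⟨hk, h⟩ := h
      subst hk
      obtain ⟨h1, h2⟩ := List.append_inj h (by simp)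
      obtain ⟨h3, h4⟩ := List.append_inj h' (by simp [Constraint.table_length])
      obtain rfl := Constraint.val_eq_of_table_eq h3
      have hv : v = v' := by
        funext i
        exact Fin.ext (congrFun (List.ofFn_injective h1) i)
      rw [hv, flatMap_inj L L' h2 h4]

end Application

/-- An instance of `MAX-PROD-CSP(F)`: a number `n` of variables and a finite set of applications of
constraints from `F`, listed without repetition. -/
structure CSPInstance (F : Set Constraint) where
  n : ℕ
  apps : List (Application n)
  nodup : apps.Nodup
  mem : ∀ a ∈ apps, a.con ∈ F

/-- An instance as machine data. -/
def CSPInstance.enc {F : Set Constraint} (x : CSPInstance F) : Word :=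
  ⟨x.n :: x.apps.flatMap Application.nats, x.apps.flatMap fun a => a.con.table⟩

theorem CSPInstance.enc_injective (F : Set Constraint) :
    Function.Injective (CSPInstance.enc (F := F)) := by
  rintro ⟨n, L, _, _⟩ ⟨n', L', _, _⟩ h
  simp only [CSPInstance.enc, Word.mk.injEq, List.cons.injEq] at h
  obtain ⟨⟨rfl, h1⟩, h2⟩ := h
  obtain rfl := Application.flatMap_inj L L' h1 h2
  rfl

/-- A truth assignment as machine data: its sequence of bits. -/
def encAssignment {n : ℕ} (σ : Fin n → Bool) : Word := ⟨List.ofFn fun i => (σ i).toNat, []⟩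

theorem encAssignment_injective (n : ℕ) : Function.Injective (encAssignment (n := n)) := by
  intro σ τ h
  simp only [encAssignment, Word.mk.injEq, and_true] at h
  funext i
  have hi : (σ i).toNat = (τ i).toNat := congrFun (List.ofFn_injective h) i
  revert hi
  cases σ i <;> cases τ i <;> simp

/-- `MAX-PROD-CSP(F)`: the solutions are the truth assignments, and the measure is the product of the
values of all applied constraints. -/
def maxProdCSP (F : Set Constraint) : MaxProblem where
  Inst := CSPInstance F
  Sol x := Fin x.n → Bool
  measure x σ := (x.apps.map fun a => a.value σ).prod
  encInst := CSPInstance.enc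
  encSol _ := encAssignment
  encInst_injective := CSPInstance.enc_injective F
  encSol_injective x := encAssignment_injective x.n

/-- `MAX-PROD-CSP*(F)`: all unary constraints are available for free. -/
def maxProdCSPStar (F : Set Constraint) : MaxProblem := maxProdCSP (F ∪ Constraint.unary)

end

/-!
Every available constraint is a product of unary constraints, equalities and disequalities. Two
variables `u`, `v` of an instance are tied with parity `e` when some application vanishes wherever
`u + v ≠ e`; the value `false` of an additional variable expresses fixed values as ties. Merging
tied variables yields classes of variables, together with an assignment that respects the ties as
far as possible. An assignment of nonzero measure respects all ties, so if there is any, it differs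
from the constructed one only by flips of whole classes. Since an equality or disequality factor
forces a tie, its variables are in one class and it does not notice such flips. Only the unary
factors do, and each of them depends on a single class. Hence flips of distinct classes have
independent effects on the measure, and it is optimal to decide class by class, greedily, whether
to flip.

The cost of a program all of whose loops are iterated at most `B` times is a polynomial in `B`, so
running times follow from correctness proofs that also bound the numbers of iterations.
-/

noncomputable section

/-! ## All available constraints are in `ED` -/

namespace Constraint

theorem EDFactor.exists_eval_eq_equation {k : ℕ} (i j : Fin k) (a b e : ZMod 2) :
    ∃ E : EDFactor k, ∀ x, E.eval x = if a * bit (x i) + b * bit (x j) = e then 1 else 0 := by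
  have zero_or_one : ∀ z : ZMod 2, z = 0 ∨ z = 1 := by decide
  rcases zero_or_one b with rfl | rfl
  · exact ⟨.unary (fun t => if a * bit t = e then 1 else 0) i, by simp [eval]⟩
  rcases zero_or_one a with rfl | rfl
  · exact ⟨.unary (fun t => if bit t = e then 1 else 0) j, by simp [eval]⟩
  rcases zero_or_one e with rfl | rfl
  · refine ⟨.eq i j, fun x => ?_⟩
    have one_add_one : (1 + 1 : ZMod 2) = 0 := by decide
    cases hi : x i <;> cases hj : x j <;> simp [eval, hi, hj, bit, one_add_one]
  · refine ⟨.xor i j, fun x => ?_⟩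
    cases hi : x i <;> cases hj : x j <;> simp [eval, hi, hj, bit]

theorem IsAffine.exists_edFactors {R : Set (Fin 2 → Bool)} (hR : IsAffine R) {k : ℕ}
    (i j : Fin k) : ∃ L : List (EDFactor k), ∀ x : Fin k → Bool,
      (L.map (EDFactor.eval x)).prod = R.indicator (1 : (Fin 2 → Bool) → ℝ≥0) ![x i, x j] := by
  obtain ⟨m, A, b, rfl⟩ := hR
  choose E hE using fun r : Fin m => EDFactor.exists_eval_eq_equation i j (A r 0) (A r 1) (b r)
  refine ⟨List.ofFn E, fun x => ?_⟩
  rw [List.map_ofFn, List.prod_ofFn]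
  simp only [Function.comp_apply, hE]
  rw [Finset.prod_ite_zero]
  simp only [Set.indicator_apply, Set.mem_ofPred_eq, funext_iff, Matrix.mulVec, dotProduct,
    Fin.sum_univ_two]
  simp

theorem AF_subset_ED : AF ⊆ ED := by
  rintro f ⟨i, g, R, ⟨u, hu⟩, hR, hf⟩
  choose L hL using fun j => (hR j).exists_edFactors i j
  refine ⟨List.ofFn (fun l => EDFactor.unary (u l) l) ++ (Finset.univ.erase i).toList.flatMap L,
    fun x => ?_⟩
  rw [hf, hu, List.map_append, List.prod_append, List.map_ofFn, List.prod_ofFn, List.map_flatMap,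
    List.flatMap_def, List.prod_flatten, List.map_map,
    ← Finset.prod_map_toList (Finset.univ.erase i)]
  congr 2
  exact List.map_congr_left fun j _ => (hL j x).symm

theorem unary_subset_ED : unary ⊆ ED := by
  rintro ⟨k, f⟩ (rfl : k = 1)
  refine ⟨[.unary (fun t => f fun _ => t) 0], fun x => ?_⟩
  simp only [List.map_cons, List.map_nil, List.prod_cons, List.prod_nil, mul_one, EDFactor.eval]
  congr 1
  funext i
  rw [Subsingleton.elim i 0]

theorem EDFactor.eval_eq_ne_zero {k : ℕ} {x : Fin k → Bool} {i j : Fin k} :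
    (EDFactor.eq i j).eval x ≠ 0 ↔ x i = x j := by simp [eval]

theorem EDFactor.eval_xor_ne_zero {k : ℕ} {x : Fin k → Bool} {i j : Fin k} :
    (EDFactor.xor i j).eval x ≠ 0 ↔ x i ≠ x j := by simp [eval]

end Constraint

/-! ## Classes of variables and greedy optimization -/

/-- A partition of the variables, which are numbered by the naturals, into classes: two variables
are in the same class if they have the same label. -/
abbrev Labelling := ℕ → ℕ

namespace Labelling

/-- Move the variables of the class `c` to the class `c'`. -/
def merge (lab : Labelling) (c c' : ℕ) : Labelling := fun w => if lab w = c then c' else lab w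

/-- The assignment `σ` with all values flipped in the classes that `S` selects. -/
def flip (lab : Labelling) (S : ℕ → Bool) (σ : ℕ → Bool) : ℕ → Bool := fun w => σ w ^^ S (lab w)

/-- Every assignment in `A` arises from `σ` by flipping whole classes. -/
def Sound (A : Set (ℕ → Bool)) (lab : Labelling) (σ : ℕ → Bool) : Prop :=
  ∀ τ ∈ A, (fun w => σ w ^^ τ w).FactorsThrough lab

/-- Flips of disjoint sets of classes have independent effects on the function `f`. It is a
multiplicative formulation, which remains meaningful at zeros of `f`. -/
def FlipsIndependent (f : (ℕ → Bool) → ℝ≥0) (lab : Labelling) : Prop :=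
  ∀ S T : ℕ → Bool, (∀ c, (S c && T c) = false) → ∀ σ,
    f σ * f (lab.flip (fun c => S c || T c) σ) = f (lab.flip S σ) * f (lab.flip T σ)

/-- No flip of classes that contain a variable below `v` increases the value of `f` at `σ`. -/
def BestBelow (f : (ℕ → Bool) → ℝ≥0) (lab : Labelling) (σ : ℕ → Bool) (v : ℕ) : Prop :=
  ∀ S : ℕ → Bool, (∀ c, S c = true → ∃ w < v, lab w = c) → f (lab.flip S σ) ≤ f σ

variable {f : (ℕ → Bool) → ℝ≥0} {A : Set (ℕ → Bool)} {lab : Labelling} {σ τ : ℕ → Bool} {v : ℕ}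

theorem merge_self (lab : Labelling) (c : ℕ) : lab.merge c c = lab := by
  funext w
  by_cases h : lab w = c <;> simp [merge, h]

theorem flip_flip (lab : Labelling) (S T : ℕ → Bool) (σ : ℕ → Bool) :
    lab.flip S (lab.flip T σ) = lab.flip (fun c => T c ^^ S c) σ := by
  funext w
  simp [flip]

/-- After the merger every variable of the class of `u` behaves as `v` did before. -/
theorem Sound.merge (h : Sound A lab σ) {u v : ℕ} {e : Bool} (he : ∀ τ ∈ A, (τ u ^^ τ v) = e) :
    Sound A (lab.merge (lab u) (lab v))
      (lab.flip (fun c => c == lab u && (σ u ^^ σ v ^^ e)) σ) := by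
  intro τ hτ
  set r : ℕ → ℕ := fun w => if lab w = lab u then v else w
  have hlab : lab.merge (lab u) (lab v) = lab ∘ r := by
    funext w
    by_cases hw : lab w = lab u <;> simp [Labelling.merge, r, hw]
  have hdiff : (fun w => lab.flip (fun c => c == lab u && (σ u ^^ σ v ^^ e)) σ w ^^ τ w) =
      (fun w => σ w ^^ τ w) ∘ r := by
    funext w
    by_cases hw : lab w = lab u
    · have hwu : (σ w ^^ τ w) = (σ u ^^ τ u) := h τ hτ hw
      have huv := he τ hτ
      simp only [flip, Function.comp_apply, r, hw, if_true, beq_self_eq_true, Bool.true_and]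
      calc (σ w ^^ (σ u ^^ σ v ^^ e) ^^ τ w)
          = ((σ w ^^ τ w) ^^ (σ u ^^ σ v ^^ e)) := Bool.xor_right_comm ..
        _ = ((σ u ^^ τ u) ^^ (σ u ^^ σ v ^^ (τ u ^^ τ v))) := by rw [hwu, huv]
        _ = (σ v ^^ τ v) := by simp [Bool.xor_comm, Bool.xor_left_comm]
    · simp [flip, r, hw, beq_eq_false_iff_ne.2 hw]
  rw [hlab, hdiff]
  exact (h τ hτ).comp_right r

theorem Sound.flip (h : Sound A lab σ) (S : ℕ → Bool) : Sound A lab (lab.flip S σ) := by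
  intro τ hτ u v huv
  have : (σ u ^^ τ u) = (σ v ^^ τ v) := h τ hτ huv
  simpa only [Labelling.flip, huv, Bool.xor_right_comm _ (S (lab v)), Bool.xor_left_inj] using this

theorem bestBelow_zero (f : (ℕ → Bool) → ℝ≥0) (lab : Labelling) (σ : ℕ → Bool) :
    BestBelow f lab σ 0 := by
  intro S hS
  have hnone : ∀ c, S c = false := fun c => by
    by_contra h
    simpa using hS c (by simpa using h)
  have hflip : lab.flip S σ = σ := by
    funext w
    simp [Labelling.flip, hnone]
  rw [hflip]

theorem BestBelow.le_max (h : BestBelow f lab σ v) (hf : FlipsIndependent f lab) (h0 : f σ ≠ 0)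
    (S : ℕ → Bool) (hS : ∀ c, S c = true → ∃ w < v + 1, lab w = c) :
    f (lab.flip S σ) ≤ max (f σ) (f (lab.flip (fun c => c == lab v) σ)) := by
  have hS' : ∀ c, c ≠ lab v → S c = true → ∃ w < v, lab w = c := by
    intro c hcv hc
    obtain ⟨w, hw, rfl⟩ := hS c hc
    exact ⟨w, lt_of_le_of_ne (Nat.le_of_lt_succ hw) fun h => hcv (h ▸ rfl), rfl⟩
  cases hv : S (lab v) with
  | false =>
    refine le_max_of_le_left (h S fun c hc => hS' c ?_ hc)
    rintro rfl
    simp [hv] at hc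
  | true =>
    set rest : ℕ → Bool := fun c => S c && !(c == lab v)
    have hrest : f (lab.flip rest σ) ≤ f σ := h rest fun c hc => by
      obtain ⟨hSc, hcv⟩ := Bool.and_eq_true_iff.1 hc
      exact hS' c (by simpa using hcv) hSc
    have hsplit : (fun c => rest c || c == lab v) = S := by
      funext c
      by_cases hcv : c = lab v
      · simp [rest, hcv, hv]
      · simp [rest, beq_eq_false_iff_ne.2 hcv]
    have hmul := hf rest (fun c => c == lab v) (fun c => by simp [rest, Bool.and_assoc]) σ
    rw [hsplit] at hmul
    refine le_max_of_le_right (le_of_mul_le_mul_left ?_ (pos_iff_ne_zero.2 h0))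
    rw [hmul]
    gcongr

theorem BestBelow.keep (h : BestBelow f lab σ v) (hf : FlipsIndependent f lab) (h0 : f σ ≠ 0)
    (hle : f (lab.flip (fun c => c == lab v) σ) ≤ f σ) : BestBelow f lab σ (v + 1) :=
  fun S hS => (h.le_max hf h0 S hS).trans (max_le le_rfl hle)

theorem BestBelow.flip (h : BestBelow f lab σ v) (hf : FlipsIndependent f lab) (h0 : f σ ≠ 0)
    (hle : f σ ≤ f (lab.flip (fun c => c == lab v) σ)) :
    BestBelow f lab (lab.flip (fun c => c == lab v) σ) (v + 1) := by
  intro S hS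
  rw [flip_flip]
  refine (h.le_max hf h0 _ fun c hc => ?_).trans (max_le hle le_rfl)
  by_cases hcv : c = lab v
  · exact ⟨v, by omega, hcv.symm⟩
  · exact hS c (by simpa [beq_eq_false_iff_ne.2 hcv] using hc)

theorem BestBelow.le_of_mem (h : BestBelow f lab σ v) (hf : DependsOn f (Set.Iio v))
    (hs : Sound A lab σ) (hτ : τ ∈ A) : f τ ≤ f σ := by
  classical
  set S : ℕ → Bool := fun c => decide (∃ w < v, lab w = c ∧ σ w ≠ τ w) with hS
  have hτS : ∀ w < v, lab.flip S σ w = τ w := by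
    intro w hw
    have hSw : S (lab w) = (σ w ^^ τ w) := by
      rw [Bool.eq_iff_iff, hS, decide_eq_true_iff, bne_iff_ne]
      refine ⟨fun ⟨w', _, hlab, hne⟩ => ?_, fun hne => ⟨w, hw, rfl, hne⟩⟩
      have heq : (σ w' ^^ τ w') = (σ w ^^ τ w) := hs τ hτ hlab
      have hxor : (σ w ^^ τ w) = true := heq ▸ bne_iff_ne.2 hne
      exact bne_iff_ne.1 hxor
    simp [Labelling.flip, hSw]
  rw [← hf hτS]
  refine h S fun c hc => ?_
  obtain ⟨w, hw, hlab, -⟩ := of_decide_eq_true hc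
  exact ⟨w, hw, hlab⟩

end Labelling

/-! ## Ties between variables -/

/-- A tuple of bits, continued by zeros. -/
def padTuple {k : ℕ} (z : Fin k → Bool) (x : ℕ) : Bool := if h : x < k then z ⟨x, h⟩ else false

theorem padTuple_of_lt {k : ℕ} (z : Fin k → Bool) {x : ℕ} (h : x < k) :
    padTuple z x = z ⟨x, h⟩ := dif_pos h

theorem padTuple_val {k : ℕ} (z : Fin k → Bool) (i : Fin k) : padTuple z i = z i :=
  padTuple_of_lt z i.2

theorem padTuple_self {k : ℕ} (z : Fin k → Bool) : padTuple z k = false := dif_neg (lt_irrefl k)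

namespace Application

open Constraint

variable {n : ℕ} {a : Application n} {L : List (Application n)} {lab : Labelling} {σ τ : ℕ → Bool}

/-- The measure of an assignment, given as a function on all naturals. -/
def total (L : List (Application n)) (σ : ℕ → Bool) : ℝ≥0 :=
  (L.map fun a => a.value fun v => σ v).prod

/-- The variable at place `x` of an application. Behind the last place stands the additional
variable `n`, whose value is meant to be `false`: in this way, a fixed value of a variable can be
expressed as a relation between two variables. -/
def varAt (a : Application n) (x : ℕ) : ℕ := if h : x < a.con.arity then a.vars ⟨x, h⟩ else n

/-- In the support of the constraint, the sum of the bits at the places `x` and `y` is `e`. -/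
def Tied (a : Application n) (x y : ℕ) (e : Bool) : Prop :=
  ∀ z, a.con.val z ≠ 0 → (padTuple z x ^^ padTuple z y) = e

/-- The assignments of nonzero measure, where the additional variable `n` has the value `false`. -/
def support (L : List (Application n)) : Set (ℕ → Bool) := {τ | total L τ ≠ 0 ∧ τ n = false}

/-- Tied variables of applications in `L` are in the same class. -/
def TiesIdentified (L : List (Application n)) (lab : Labelling) : Prop :=
  ∀ a ∈ L, ∀ x ≤ a.con.arity, ∀ y ≤ a.con.arity, ∀ e, a.Tied x y e →
    lab (a.varAt x) = lab (a.varAt y)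

theorem varAt_val (a : Application n) (i : Fin a.con.arity) : a.varAt i = a.vars i := dif_pos i.2

theorem varAt_arity (a : Application n) : a.varAt a.con.arity = n := dif_neg (lt_irrefl _)

theorem varAt_le (a : Application n) (x : ℕ) : a.varAt x ≤ n := by
  unfold varAt
  split_ifs
  · exact Fin.is_le'
  · exact le_rfl

theorem apply_varAt (a : Application n) (hτ : τ n = false) (x : ℕ) :
    τ (a.varAt x) = padTuple (fun i => τ (a.vars i)) x := by
  unfold varAt padTuple
  split_ifs <;> simp [hτ]

theorem dependsOn_total (L : List (Application n)) : DependsOn (total L) (Set.Iio n) := by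
  intro σ τ h
  have hfin : (fun v : Fin n => σ v) = fun v : Fin n => τ v := funext fun v => h v v.2
  simp only [total, hfin]

theorem total_ne_zero : total L σ ≠ 0 ↔ ∀ a ∈ L, (a.value fun v => σ v) ≠ 0 := by
  simp [total, List.prod_eq_zero_iff]

theorem Tied.apply (h : τ ∈ support L) (ha : a ∈ L) {x y : ℕ} {e : Bool} (ht : a.Tied x y e) :
    (τ (a.varAt x) ^^ τ (a.varAt y)) = e := by
  rw [apply_varAt a h.2, apply_varAt a h.2]
  exact ht _ (total_ne_zero.1 h.1 a ha)

section Factors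

variable {M : List (EDFactor a.con.arity)} (hM : ∀ x, a.con.val x = (M.map (EDFactor.eval x)).prod)
include hM

theorem eval_ne_zero_of_mem {E : EDFactor a.con.arity} (hE : E ∈ M) {z : Fin a.con.arity → Bool}
    (hz : a.con.val z ≠ 0) : E.eval z ≠ 0 :=
  fun h0 => hz ((hM z).trans (List.prod_eq_zero (h0 ▸ List.mem_map_of_mem hE)))

theorem tied_of_eq_mem {i j : Fin a.con.arity} (hE : .eq i j ∈ M) : a.Tied i j false := by
  intro z hz
  have := EDFactor.eval_eq_ne_zero.1 (eval_ne_zero_of_mem hM hE hz)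
  simp [padTuple_val, this]

theorem tied_of_xor_mem {i j : Fin a.con.arity} (hE : .xor i j ∈ M) : a.Tied i j true := by
  intro z hz
  have := EDFactor.eval_xor_ne_zero.1 (eval_ne_zero_of_mem hM hE hz)
  simpa [padTuple_val] using this

theorem tied_of_unary_mem {u : Bool → ℝ≥0} {i : Fin a.con.arity} (hE : .unary u i ∈ M) {t : Bool}
    (ht : u (!t) = 0) : a.Tied i a.con.arity t := by
  intro z hz
  have hu : u (z i) ≠ 0 := eval_ne_zero_of_mem hM hE hz
  rw [padTuple_val, padTuple_self, Bool.xor_false]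
  by_contra h
  exact hu (Bool.eq_not.2 h ▸ ht)

end Factors

theorem TiesIdentified.lab_eq (hc : TiesIdentified L lab) (ha : a ∈ L) {i j : Fin a.con.arity}
    {e : Bool} (h : a.Tied i j e) : lab (a.vars i) = lab (a.vars j) := by
  simpa only [varAt_val] using hc a ha i i.2.le j j.2.le e h

/-- Tied variables are flipped together, so that a flip only affects the unary factors. -/
theorem TiesIdentified.flipsIndependent (hc : TiesIdentified L lab) (hL : ∀ a ∈ L, a.con ∈ ED) :
    lab.FlipsIndependent (total L) := by
  intro S T hST σ
  simp only [total, ← List.prod_map_mul]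
  congr 1
  refine List.map_congr_left fun a ha => ?_
  obtain ⟨M, hM⟩ := hL a ha
  simp only [value, hM, ← List.prod_map_mul]
  congr 1
  refine List.map_congr_left fun E hE => ?_
  cases E with
  | unary u i =>
    have := hST (lab (a.vars i))
    simp only [EDFactor.eval, Labelling.flip]
    cases hS : S (lab (a.vars i)) <;> cases hT : T (lab (a.vars i)) <;> simp_all [mul_comm]
  | eq i j =>
    simp only [EDFactor.eval, Labelling.flip, hc.lab_eq ha (tied_of_eq_mem hM hE),
      Bool.xor_left_inj]
  | xor i j =>
    simp only [EDFactor.eval, Labelling.flip, hc.lab_eq ha (tied_of_xor_mem hM hE),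
      Bool.xor_left_inj]

theorem TiesIdentified.total_ne_zero (hc : TiesIdentified L lab) (hL : ∀ a ∈ L, a.con ∈ ED)
    (hs : lab.Sound (support L) σ) (hn : σ n = false) (hτ : τ ∈ support L) : total L σ ≠ 0 := by
  refine Application.total_ne_zero.2 fun a ha => ?_
  obtain ⟨M, hM⟩ := hL a ha
  have hagree : ∀ {x y e}, x ≤ a.con.arity → y ≤ a.con.arity → a.Tied x y e →
      (σ (a.varAt x) ^^ τ (a.varAt x)) = (σ (a.varAt y) ^^ τ (a.varAt y)) :=
    fun hx hy ht => hs τ hτ (hc a ha _ hx _ hy _ ht)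
  have hτa := Application.total_ne_zero.1 hτ.1 a ha
  rw [value, hM]
  refine List.prod_ne_zero fun h0 => ?_
  obtain ⟨E, hE, hE0⟩ := List.mem_map.1 h0
  have hτE := eval_ne_zero_of_mem hM hE hτa
  revert hE0
  cases E with
  | unary u i =>
    intro (h0 : u (σ (a.vars i)) = 0)
    have hne : σ (a.vars i) ≠ τ (a.vars i) := fun h => hτE (by rwa [h] at h0)
    have hnot : (!τ (a.vars i)) = σ (a.vars i) := (Bool.eq_not.2 hne).symm
    have := hagree i.2.le le_rfl (tied_of_unary_mem hM hE (t := τ (a.vars i)) (hnot ▸ h0))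
    simp [varAt_val, varAt_arity, hn, hτ.2, hne] at this
  | eq i j =>
    have := hagree i.2.le j.2.le (tied_of_eq_mem hM hE)
    have hτij : τ (a.vars i) = τ (a.vars j) := EDFactor.eval_eq_ne_zero.1 hτE
    rw [varAt_val, varAt_val, hτij, Bool.xor_left_inj] at this
    exact EDFactor.eval_eq_ne_zero.2 this
  | xor i j =>
    have := hagree i.2.le j.2.le (tied_of_xor_mem hM hE)
    rw [varAt_val, varAt_val] at this
    refine EDFactor.eval_xor_ne_zero.2 fun h => EDFactor.eval_xor_ne_zero.1 hτE ?_
    rwa [h, Bool.xor_right_inj] at this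

end Application

namespace RealRAM

/-! ## A program logic for the machine -/

/-- A bound for the running time when every loop is iterated at most `B` times. -/
def Prog.cost (B : ℕ) : Prog → ℕ
  | .instr _ => 1
  | .seq c d => c.cost B + d.cost B
  | .ite _ c d => c.cost B + d.cost B + 1
  | .loop _ c => B * (c.cost B + 1) + 1

theorem Prog.exists_cost_poly (c : Prog) : ∃ p : Polynomial ℕ, ∀ B, p.eval B = c.cost B := by
  induction c with
  | instr a => exact ⟨1, by simp [Prog.cost]⟩
  | seq c d hc hd =>
    obtain ⟨p, hp⟩ := hc
    obtain ⟨q, hq⟩ := hd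
    exact ⟨p + q, by simp [Prog.cost, hp, hq]⟩
  | ite b c d hc hd =>
    obtain ⟨p, hp⟩ := hc
    obtain ⟨q, hq⟩ := hd
    exact ⟨p + q + 1, by simp [Prog.cost, hp, hq]⟩
  | loop b c hc =>
    obtain ⟨p, hp⟩ := hc
    exact ⟨Polynomial.X * (p + 1) + 1, by simp [Prog.cost, hp]⟩

theorem Prog.exists_poly_comp_cost (c : Prog) (f : Polynomial ℕ) :
    ∃ p : Polynomial ℕ, ∀ N, p.eval N = c.cost (f.eval N) := by
  obtain ⟨p, hp⟩ := c.exists_cost_poly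
  exact ⟨p.comp f, by simp [hp]⟩

theorem Exec.le_cost {B : ℕ} {c : Prog} {s s' : State} {t : ℕ} (h : Exec c s s' t)
    (ht : t ≤ B) : t ≤ c.cost B := by
  have key : ∀ k, B ≤ B * (k + 1) + 1 := fun k => by nlinarith
  induction h with
  | instr => simp [Prog.cost]
  | seq _ _ h1 h2 => have := h1 (by omega); have := h2 (by omega); simp only [Prog.cost]; omega
  | iteTrue _ _ h1 => have := h1 (by omega); simp only [Prog.cost]; omega
  | iteFalse _ _ h1 => have := h1 (by omega); simp only [Prog.cost]; omega
  | loopTrue _ _ _ _ _ => simp only [Prog.cost]; exact ht.trans (key _)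
  | loopFalse _ => simp only [Prog.cost]; exact ht.trans (key _)

/-- Some instruction of the program satisfies `f`. -/
def Prog.any (f : Instr → Bool) : Prog → Bool
  | .instr a => f a
  | .seq c d => c.any f || d.any f
  | .ite _ c d => c.any f || d.any f
  | .loop _ c => c.any f

/-- The program may change the natural register `r`. -/
abbrev Prog.writesNat (c : Prog) (r : ℕ) : Bool :=
  c.any fun
    | .setNat r' _ => r' == r
    | _ => false

/-- The program may change the real register `r`. -/
abbrev Prog.writesReal (c : Prog) (r : ℕ) : Bool :=
  c.any fun
    | .setReal r' _ => r' == r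
    | _ => false

/-- The program may change the array `x` of naturals. -/
abbrev Prog.writesNatArr (c : Prog) (x : ℕ) : Bool :=
  c.any fun
    | .clearNat y | .pushNat y _ | .popNat y | .writeNat y _ _ => y == x
    | _ => false

/-- The program may change the array `x` of reals. -/
abbrev Prog.writesRealArr (c : Prog) (x : ℕ) : Bool :=
  c.any fun
    | .clearReal y | .pushReal y _ | .popReal y | .writeReal y _ _ => y == x
    | _ => false

/-- `s'` agrees with `s` on everything that `c` does not write. -/
structure Frame (c : Prog) (s s' : State) : Prop where
  nat : ∀ r, c.writesNat r = false → s'.natReg r = s.natReg r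
  real : ∀ r, c.writesReal r = false → s'.realReg r = s.realReg r
  natArr : ∀ x, c.writesNatArr x = false → s'.natArr x = s.natArr x
  realArr : ∀ x, c.writesRealArr x = false → s'.realArr x = s.realArr x

theorem Frame.refl (c : Prog) (s : State) : Frame c s s :=
  ⟨fun _ _ => rfl, fun _ _ => rfl, fun _ _ => rfl, fun _ _ => rfl⟩

theorem Frame.trans {c : Prog} {s s' s'' : State} (h : Frame c s s') (h' : Frame c s' s'') :
    Frame c s s'' :=
  ⟨fun r hr => (h'.nat r hr).trans (h.nat r hr), fun r hr => (h'.real r hr).trans (h.real r hr),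
    fun r hr => (h'.natArr r hr).trans (h.natArr r hr),
    fun r hr => (h'.realArr r hr).trans (h.realArr r hr)⟩

theorem Frame.mono {c d : Prog} {s s' : State} (h : Frame c s s')
    (hcd : ∀ f, d.any f = false → c.any f = false) : Frame d s s' :=
  ⟨fun r hr => h.nat r (hcd _ hr), fun r hr => h.real r (hcd _ hr),
    fun r hr => h.natArr r (hcd _ hr), fun r hr => h.realArr r (hcd _ hr)⟩

theorem Frame.exec (a : Instr) (s : State) : Frame (.instr a) s (a.exec s) := by
  constructor <;> intro r hr <;> cases a <;> first
    | rfl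
    | exact Function.update_of_ne (ne_of_beq_false hr).symm ..

theorem Exec.frame {c : Prog} {s s' : State} {t : ℕ} (h : Exec c s s' t) : Frame c s s' := by
  induction h with
  | instr a s => exact Frame.exec a s
  | seq _ _ h1 h2 =>
    exact (h1.mono (by simp +contextual [Prog.any])).trans
      (h2.mono (by simp +contextual [Prog.any]))
  | iteTrue _ _ h1 => exact h1.mono (by simp +contextual [Prog.any])
  | iteFalse _ _ h1 => exact h1.mono (by simp +contextual [Prog.any])
  | loopTrue _ _ _ h1 h2 => exact (h1.mono (by simp +contextual [Prog.any])).trans h2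
  | loopFalse _ => exact Frame.refl _ _

/-- Started in `s`, the program `c` halts in a state with property `Q`, within the time that
corresponds to at most `B` iterations of every loop. -/
def Runs (B : ℕ) (c : Prog) (s : State) (Q : State → Prop) : Prop :=
  ∃ s' t, Exec c s s' t ∧ t ≤ c.cost B ∧ Q s'

variable {B : ℕ} {a : Instr} {b : Test} {c d : Prog} {s : State} {P Q : State → Prop}

theorem runs_instr : Runs B (.instr a) s Q ↔ Q (a.exec s) := by
  constructor
  · rintro ⟨s', t, h, -, hQ⟩
    cases h
    exact hQ
  · exact fun h => ⟨_, _, .instr a s, le_rfl, h⟩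

theorem runs_seq (h : Runs B c s fun s' => Runs B d s' Q) : Runs B (.seq c d) s Q := by
  obtain ⟨s', t, h1, h2, s'', t', h3, h4, h5⟩ := h
  exact ⟨s'', _, .seq h1 h3, by simp only [Prog.cost]; omega, h5⟩

theorem runs_instr_seq (h : Runs B d (a.exec s) Q) : Runs B (.seq (.instr a) d) s Q :=
  runs_seq (runs_instr.2 h)

theorem runs_ite (h1 : b.Holds s → Runs B c s Q) (h2 : ¬ b.Holds s → Runs B d s Q) :
    Runs B (.ite b c d) s Q := by
  by_cases hb : b.Holds s
  · obtain ⟨s', t, h3, h4, h5⟩ := h1 hb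
    exact ⟨s', _, .iteTrue hb h3, by simp only [Prog.cost]; omega, h5⟩
  · obtain ⟨s', t, h3, h4, h5⟩ := h2 hb
    exact ⟨s', _, .iteFalse hb h3, by simp only [Prog.cost]; omega, h5⟩

theorem Runs.imp (h : Runs B c s P) (hQ : ∀ s', Frame c s s' → P s' → Q s') : Runs B c s Q := by
  obtain ⟨s', t, h1, h2, h3⟩ := h
  exact ⟨s', t, h1, h2, hQ s' h1.frame h3⟩

theorem Runs.seq (h : Runs B c s P) (hQ : ∀ s', Frame c s s' → P s' → Runs B d s' Q) :
    Runs B (.seq c d) s Q :=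
  runs_seq (h.imp hQ)

/-- The number in the invariant `Inv` bounds the number of iterations that are still to come. -/
theorem runs_loop {N : ℕ} (hN : N ≤ B) (Inv : ℕ → State → Prop) (h0 : Inv N s)
    (step : ∀ m s', Frame c s s' → Inv m s' → b.Holds s' →
      Runs B c s' fun s'' => ∃ m' < m, Inv m' s'')
    (post : ∀ m s', Frame c s s' → Inv m s' → ¬ b.Holds s' → Q s') : Runs B (.loop b c) s Q := by
  have bounded : ∀ M m s', m ≤ M → Frame c s s' → Inv m s' →
      ∃ s'' t, Exec (.loop b c) s' s'' t ∧ t ≤ M * (c.cost B + 1) + 1 ∧ Q s'' := by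
    intro M
    induction M with
    | zero =>
      intro m s' hm hf hI
      by_cases hb : b.Holds s'
      · obtain ⟨_, _, _, _, m', hm', _⟩ := step m s' hf hI hb
        omega
      · exact ⟨s', 1, .loopFalse hb, by omega, post m s' hf hI hb⟩
    | succ M ih =>
      intro m s' hm hf hI
      by_cases hb : b.Holds s'
      · obtain ⟨s1, t1, h1, h2, m', hm', h3⟩ := step m s' hf hI hb
        obtain ⟨s2, t2, h4, h5, h6⟩ := ih m' s1 (by omega) (hf.trans h1.frame) h3
        exact ⟨s2, _, .loopTrue hb h1 h4, by rw [Nat.succ_mul]; omega, h6⟩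
      · exact ⟨s', 1, .loopFalse hb, by omega, post m s' hf hI hb⟩
  obtain ⟨s', t, h1, h2, h3⟩ := bounded N N s le_rfl (.refl _ _) h0
  exact ⟨s', t, h1, h2.trans (by simp only [Prog.cost]; gcongr), h3⟩

theorem Runs.yields {w v : Word} {T : ℕ} (h : Runs B c (State.init w) fun s => s.output = v)
    (hT : c.cost B ≤ T) : c.Yields w v T := by
  obtain ⟨s, t, h1, h2, h3⟩ := h
  exact ⟨s, t, h1, h2.trans hT, h3⟩

instance : Add NatExp := ⟨.add⟩
instance : Sub NatExp := ⟨.sub⟩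

@[simp] theorem NatExp.eval_add (e₁ e₂ : NatExp) : (e₁ + e₂).eval s = e₁.eval s + e₂.eval s := rfl
@[simp] theorem NatExp.eval_sub (e₁ e₂ : NatExp) : (e₁ - e₂).eval s = e₁.eval s - e₂.eval s := rfl

/-- `e₁ < e₂` -/
abbrev Test.lt (e₁ e₂ : NatExp) : Test := .not (.natLe e₂ e₁)

/-- `e₁ = e₂` -/
abbrev Test.eq (e₁ e₂ : NatExp) : Test := .and (.natLe e₁ e₂) (.natLe e₂ e₁)

/-- `e₁ = e₂` for reals -/
abbrev Test.realEq (e₁ e₂ : RealExp) : Test := .and (.realLe e₁ e₂) (.realLe e₂ e₁)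

@[simp] theorem Test.holds_lt (e₁ e₂ : NatExp) :
    (Test.lt e₁ e₂).Holds s ↔ e₁.eval s < e₂.eval s := by simp [Test.Holds]

@[simp] theorem Test.holds_eq (e₁ e₂ : NatExp) :
    (Test.eq e₁ e₂).Holds s ↔ e₁.eval s = e₂.eval s := by
  simp only [Test.Holds]; omega

@[simp] theorem Test.holds_realEq (e₁ e₂ : RealExp) :
    (Test.realEq e₁ e₂).Holds s ↔ e₁.eval s = e₂.eval s := by
  simp only [Test.Holds]; exact ⟨fun h => le_antisymm h.1 h.2, fun h => ⟨h.le, h.ge⟩⟩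

/-- Assignment to a natural register. -/
abbrev setN (r : ℕ) (e : NatExp) : Prog := .instr (.setNat r e)

/-- Assignment to a real register. -/
abbrev setR (r : ℕ) (e : RealExp) : Prog := .instr (.setReal r e)

infixr:60 " ;; " => Prog.seq

/-- Execute `c` while the register `r` counts from `0` up to the value of `e`. -/
def forN (r : ℕ) (e : NatExp) (c : Prog) : Prog :=
  setN r (.const 0) ;; .loop (.lt (.reg r) e) (c ;; setN r (.reg r + .const 1))

theorem runs_forN {r N : ℕ} {e : NatExp} (Inv : ℕ → State → Prop) (hr : c.writesNat r = false)
    (hN : N ≤ B) (he : ∀ s', Frame (forN r e c) s s' → e.eval s' = N)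
    (hInv : ∀ i s v, Inv i s → Inv i { s with natReg := Function.update s.natReg r v })
    (h0 : Inv 0 s)
    (step : ∀ i < N, ∀ s', Frame (forN r e c) s s' → s'.natReg r = i → Inv i s' →
      Runs B c s' (Inv (i + 1))) :
    Runs B (forN r e c) s (Inv N) := by
  have hsub : ∀ f, (forN r e c).any f = false → (setN r (.const 0)).any f = false ∧
      c.any f = false ∧ (setN r (.reg r + .const 1)).any f = false := by
    simp +contextual [forN, Prog.any]
  refine runs_instr_seq (runs_loop hN (fun m s' => ∃ i, i + m = N ∧ Frame (forN r e c) s s' ∧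
    s'.natReg r = i ∧ Inv i s') ⟨0, by omega, ?_, ?_, hInv _ _ _ h0⟩ ?_ ?_)
  · exact (Frame.exec _ s).mono fun f hf => (hsub f hf).1
  · simp [Instr.exec, NatExp.eval]
  · rintro m s' - ⟨i, hi, hf, hri, hI⟩ hb
    rw [Test.holds_lt, he s' hf, NatExp.eval, hri] at hb
    refine (step i hb s' hf hri hI).seq fun s2 hf2 hI2 => runs_instr.2
      ⟨m - 1, by omega, i + 1, by omega, ?_, ?_, hInv _ _ _ hI2⟩
    · exact (hf.trans (hf2.mono fun f hf => (hsub f hf).2.1)).trans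
        ((Frame.exec _ s2).mono fun f hf => (hsub f hf).2.2)
    · simp [Instr.exec, NatExp.eval, hf2.nat r hr, hri]
  · rintro m s' - ⟨i, hi, hf, hri, hI⟩ hb
    rw [Test.holds_lt, he s' hf, NatExp.eval, hri] at hb
    rwa [show N = i by omega]

end RealRAM

attribute [-simp] List.getD_eq_getElem?_getD List.length_flatMap
attribute [local simp] RealRAM.Instr.exec RealRAM.NatExp.eval RealRAM.RealExp.eval

/-! ## Instances in memory -/

namespace Application

variable {n : ℕ} {L : List (Application n)}

/-- The application `a` is described by the naturals from position `p` on and the reals from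
position `q` on. -/
structure StoredAt (a : Application n) (N : List ℕ) (R : List ℝ) (p q : ℕ) : Prop where
  arity : N.getD p 0 = a.con.arity
  vars : ∀ i (h : i < a.con.arity), N.getD (p + 1 + i) 0 = a.vars ⟨i, h⟩
  table : ∀ m < 2 ^ a.con.arity,
    R.getD (q + m) 0 = (a.con.val (Constraint.lexTuple a.con.arity m) : ℝ)

theorem StoredAt.varAt_eq {a : Application n} {N : List ℕ} {R : List ℝ} {p q : ℕ}
    (h : a.StoredAt N R p q) (x : ℕ) :
    a.varAt x = if x < a.con.arity then N.getD (p + 1 + x) 0 else n := by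
  unfold varAt
  split_ifs with hx
  · exact (h.vars x hx).symm
  · rfl

/-- Position of the naturals of the `i`-th application. -/
def natPos (start : ℕ) (L : List (Application n)) (i : ℕ) : ℕ :=
  start + ((L.take i).flatMap nats).length

/-- Position of the reals of the `i`-th application. -/
def realPos (L : List (Application n)) (i : ℕ) : ℕ :=
  ((L.take i).flatMap fun a => a.con.table).length

theorem length_nats (a : Application n) : a.nats.length = a.con.arity + 1 := by simp [nats]

theorem length_le_length_flatMap (L : List (Application n)) :
    L.length ≤ (L.flatMap nats).length := by
  induction L with
  | nil => simp
  | cons a L ih =>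
    rw [List.flatMap_cons, List.length_append, List.length_cons, length_nats]
    omega

theorem arity_lt_length_flatMap {a : Application n} (h : a ∈ L) :
    a.con.arity < (L.flatMap nats).length := by
  obtain ⟨L₁, L₂, rfl⟩ := List.append_of_mem h
  simp only [List.flatMap_append, List.flatMap_cons, List.length_append, length_nats]
  omega

theorem two_pow_le_length_flatMap {a : Application n} (h : a ∈ L) :
    2 ^ a.con.arity ≤ (L.flatMap fun a => a.con.table).length := by
  obtain ⟨L₁, L₂, rfl⟩ := List.append_of_mem h
  simp only [List.flatMap_append, List.flatMap_cons, List.length_append, Constraint.table_length]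
  omega

theorem natPos_succ (start : ℕ) {i : ℕ} (h : i < L.length) :
    natPos start L (i + 1) = natPos start L i + L[i].con.arity + 1 := by
  simp only [natPos, List.take_succ_eq_append_getElem h, List.flatMap_append, List.length_append,
    List.flatMap_cons, List.flatMap_nil, List.append_nil, length_nats]
  omega

theorem realPos_succ {i : ℕ} (h : i < L.length) :
    realPos L (i + 1) = realPos L i + 2 ^ L[i].con.arity := by
  simp only [realPos, List.take_succ_eq_append_getElem h, List.flatMap_append, List.length_append,
    List.flatMap_cons, List.flatMap_nil, List.append_nil, Constraint.table_length]

theorem natPos_lt_natPos_length (start : ℕ) {i : ℕ} (h : i < L.length) :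
    natPos start L i < natPos start L L.length := by
  have hsplit : L.flatMap nats = (L.take i).flatMap nats ++ (L.drop i).flatMap nats := by
    rw [← List.flatMap_append, List.take_append_drop]
  have := length_le_length_flatMap (L.drop i)
  simp only [natPos, List.take_length, hsplit, List.length_append, List.length_drop] at this ⊢
  omega

theorem total_take_succ {i : ℕ} (h : i < L.length) (σ : ℕ → Bool) :
    total (L.take (i + 1)) σ = total (L.take i) σ * L[i].value fun v => σ v := by
  simp only [total, List.take_succ_eq_append_getElem h, List.map_append, List.prod_append,
    List.map_cons, List.map_nil, List.prod_cons, List.prod_nil, mul_one]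

/-- The list `L` of applications is described by the naturals between the positions `start` and
`limit` and by the reals from position `0` on. -/
structure Encodes (L : List (Application n)) (N : List ℕ) (R : List ℝ) (start limit : ℕ) :
    Prop where
  stored : ∀ i (h : i < L.length), L[i].StoredAt N R (natPos start L i) (realPos L i)
  limit_eq : natPos start L L.length = limit

theorem getD_append_append {α : Type*} (l₁ l₂ l₃ : List α) {i : ℕ} (d : α) (h : i < l₂.length) :
    (l₁ ++ l₂ ++ l₃).getD (l₁.length + i) d = l₂[i] := by
  rw [List.append_assoc, List.getD_append_right _ _ _ _ (by omega),
    List.getD_append _ _ _ _ (by omega), List.getD_eq_getElem _ _ (by omega)]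
  simp only [Nat.add_sub_cancel_left]

theorem storedAt_append (a : Application n) (N₁ N₂ : List ℕ) (R₁ R₂ : List ℝ) :
    a.StoredAt (N₁ ++ a.nats ++ N₂) (R₁ ++ a.con.table ++ R₂) N₁.length R₁.length where
  arity := by simpa [nats] using getD_append_append N₁ a.nats N₂ (i := 0) 0 (by simp [nats])
  vars i h := by
    rw [Nat.add_assoc,
      getD_append_append N₁ a.nats N₂ (i := 1 + i) 0 (by rw [length_nats]; omega)]
    simp [nats, Nat.add_comm 1 i]
  table m h := by
    rw [getD_append_append R₁ a.con.table R₂ 0 (by rwa [Constraint.table_length])]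
    simp [Constraint.table]

theorem encodes_append (L : List (Application n)) (N₁ N₂ : List ℕ) (R₂ : List ℝ) :
    Encodes L (N₁ ++ L.flatMap nats ++ N₂) (L.flatMap (fun a => a.con.table) ++ R₂) N₁.length
      (N₁.length + (L.flatMap nats).length) := by
  refine ⟨fun i h => ?_, by simp [natPos]⟩
  have hL : L = L.take i ++ L[i] :: L.drop (i + 1) := by simp
  have := storedAt_append L[i] (N₁ ++ (L.take i).flatMap nats)
    ((L.drop (i + 1)).flatMap nats ++ N₂) ((L.take i).flatMap fun a => a.con.table)
    ((L.drop (i + 1)).flatMap (fun a => a.con.table) ++ R₂)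
  rw [List.length_append] at this
  convert this using 1
  · conv_lhs => rw [hL]
    simp only [List.flatMap_append, List.flatMap_cons, List.append_assoc]
  · conv_lhs => rw [hL]
    simp only [List.flatMap_append, List.flatMap_cons, List.append_assoc]
  · rfl
  · rfl

end Application

/- Natural registers. The application at work has its naturals at position `rPos` and its table at
position `rTab` of the input, the arity `rArity`, and the table size `rSize = 2 ^ rArity`. The
naturals of all applications stand between the positions `rStart` and `rEnd`. `rFlag` is the answer
of a decision. `rOld`, `rNew` and `rBit` are the arguments of a relabelling; `rX` and `rY` are
places of an application, `rU` and `rV` the variables there. -/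
local notation "rVars" => 0
local notation "rPos" => 1
local notation "rTab" => 2
local notation "rArity" => 3
local notation "rSize" => 4
local notation "rPlace" => 5
local notation "rIndex" => 6
local notation "rRest" => 7
local notation "rFlag" => 8
local notation "rX" => 9
local notation "rY" => 10
local notation "rU" => 11
local notation "rV" => 12
local notation "rOld" => 13
local notation "rNew" => 14
local notation "rBit" => 15
local notation "rCount" => 16
local notation "rVar" => 17
local notation "rStart" => 20
local notation "rEnd" => 21
local notation "rNewTab" => 22
local notation "rNewSize" => 23
local notation "rSame" => 24

/- Arrays of naturals, besides the input in the arrays number `0`: the labels and the values of the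
variables, and the arguments at the entry number `rIndex` of a table. -/
local notation "aLabels" => 1
local notation "aBits" => 2
local notation "aRow" => 4

namespace RealRAM

open Application

variable {B n : ℕ} {s s' : State} {c body : Prog} {a : Application n} {L : List (Application n)}

/-! ## Scanning the applications -/

/-- The registers that describe the application at work contain the data of `a`. -/
structure State.At (s : State) (a : Application n) : Prop where
  stored : a.StoredAt (s.natArr 0) (s.realArr 0) (s.natReg rPos) (s.natReg rTab)
  arity : s.natReg rArity = a.con.arity
  size : s.natReg rSize = 2 ^ a.con.arity

/-- The program may change the input or the description of the application at work. -/
abbrev Prog.writesApp (c : Prog) : Bool :=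
  c.writesNat rPos || c.writesNat rTab || c.writesNat rArity || c.writesNat rSize ||
    c.writesNatArr 0 || c.writesRealArr 0

theorem State.At.frame (h : s.At a) (hf : Frame c s s') (hc : c.writesApp = false) : s'.At a := by
  simp only [Bool.or_eq_false_iff] at hc
  obtain ⟨⟨⟨⟨⟨h1, h2⟩, h3⟩, h4⟩, h5⟩, h6⟩ := hc
  refine ⟨?_, (hf.nat _ h3).trans h.arity, (hf.nat _ h4).trans h.size⟩
  rw [hf.nat _ h1, hf.nat _ h2, hf.natArr _ h5, hf.realArr _ h6]
  exact h.stored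

/-- Move to the first application. -/
def startScan : Prog := setN rPos (.reg rStart) ;; setN rTab (.const 0)

/-- Compute the description of the application whose position is given. -/
def enterApp : Prog :=
  setN rArity (.get 0 (.reg rPos)) ;; setN rSize (.const 1) ;;
  forN rPlace (.reg rArity) (setN rSize (.reg rSize + .reg rSize))

theorem runs_enterApp_of_getD {k : ℕ} (hk : (s.natArr 0).getD (s.natReg rPos) 0 = k)
    (hB : k ≤ B) :
    Runs B enterApp s fun s' => s'.natReg rArity = k ∧ s'.natReg rSize = 2 ^ k := by
  refine runs_instr_seq (runs_instr_seq ((runs_forN (fun i s' => s'.natReg rSize = 2 ^ i)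
    rfl hB (fun s' hf => ?_) ?_ ?_ ?_).imp fun s' hf h => ⟨?_, h⟩))
  · simp [hf.nat rArity rfl, hk]
  · simp
  · simp
  · intro i _ s' _ _ h
    exact runs_instr.2 (by simp [h, pow_succ]; omega)
  · simp [hf.nat rArity rfl, hk]

theorem runs_enterApp (hB : a.con.arity ≤ B)
    (hs : a.StoredAt (s.natArr 0) (s.realArr 0) (s.natReg rPos) (s.natReg rTab)) :
    Runs B enterApp s fun s' => s'.At a := by
  refine (runs_enterApp_of_getD hs.arity hB).imp fun s' hf h => ⟨?_, h.1, h.2⟩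
  rwa [hf.nat rPos rfl, hf.nat rTab rfl, hf.natArr 0 rfl, hf.realArr 0 rfl]

/-- Move from the application at work to the next one. -/
def leaveApp : Prog :=
  setN rPos (.reg rPos + .reg rArity + .const 1) ;; setN rTab (.reg rTab + .reg rSize)

theorem runs_leaveApp {st i : ℕ} (hi : i < L.length) (hs : s.At L[i])
    (hp : s.natReg rPos = natPos st L i) (hq : s.natReg rTab = realPos L i) :
    Runs B leaveApp s fun s' =>
      s'.natReg rPos = natPos st L (i + 1) ∧ s'.natReg rTab = realPos L (i + 1) :=
  runs_instr_seq (runs_instr.2 (by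
    simp [hs.arity, hs.size, natPos_succ _ hi, realPos_succ hi, hp, hq]))

/-- Execute `body` for all applications. -/
def scan (body : Prog) : Prog :=
  startScan ;; .loop (.lt (.reg rPos) (.reg rEnd)) (enterApp ;; body ;; leaveApp)

theorem scan_any {f : Instr → Bool} (h : (scan body).any f = false) : startScan.any f = false ∧
    enterApp.any f = false ∧ body.any f = false ∧ leaveApp.any f = false := by
  simpa only [scan, Prog.any, Bool.or_eq_false_iff] using h

theorem scan_frame_input (happ : body.writesApp = false) (hend : body.writesNat rEnd = false)
    (hf : Frame (scan body) s s') :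
    s'.natReg rEnd = s.natReg rEnd ∧ s'.natArr 0 = s.natArr 0 ∧ s'.realArr 0 = s.realArr 0 := by
  simp only [Bool.or_eq_false_iff] at happ
  refine ⟨hf.nat _ ?_, hf.natArr _ ?_, hf.realArr _ ?_⟩ <;>
    simp [scan, startScan, enterApp, leaveApp, forN, Prog.any, hend, happ]

theorem runs_scan (happ : body.writesApp = false) (hend : body.writesNat rEnd = false)
    (hE : Encodes L (s.natArr 0) (s.realArr 0) (s.natReg rStart) (s.natReg rEnd))
    (hB : (L.flatMap nats).length ≤ B) (Inv : ℕ → State → Prop)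
    (hInv : ∀ i s s', Frame (startScan ;; enterApp ;; leaveApp) s s' → Inv i s → Inv i s')
    (h0 : Inv 0 s)
    (step : ∀ i (h : i < L.length) s', Frame (scan body) s s' → s'.At L[i] →
      s'.natReg rPos = natPos (s.natReg rStart) L i → s'.natReg rTab = realPos L i → Inv i s' →
      Runs B body s' (Inv (i + 1))) :
    Runs B (scan body) s (Inv L.length) := by
  have hInv' : ∀ {c i s s'}, Frame c s s' → c = startScan ∨ c = enterApp ∨ c = leaveApp →
      Inv i s → Inv i s' := fun hf hc => hInv _ _ _ (hf.mono fun f h => by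
    simp only [Prog.any, Bool.or_eq_false_iff] at h
    rcases hc with rfl | rfl | rfl <;> simp only [h])
  have hbody := happ
  simp only [Bool.or_eq_false_iff] at hbody
  have hinit : Runs B startScan s fun s' =>
      s'.natReg rPos = s.natReg rStart ∧ s'.natReg rTab = 0 :=
    runs_instr_seq (runs_instr.2 (by simp))
  refine hinit.seq fun s0 hf0 ⟨hp0, hq0⟩ => runs_loop
    ((length_le_length_flatMap L).trans hB)
    (fun m s' => ∃ i, i + m = L.length ∧ Frame (scan body) s s' ∧
      s'.natReg rPos = natPos (s.natReg rStart) L i ∧ s'.natReg rTab = realPos L i ∧ Inv i s')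
    ⟨0, by omega, hf0.mono fun f hf => (scan_any hf).1, by simp [hp0, natPos],
      by simp [hq0, realPos], hInv' hf0 (.inl rfl) h0⟩ ?_ ?_
  · rintro m s1 - ⟨i, hi, hf1, hp, hq, hI⟩ hb
    obtain ⟨hr, hN, hR⟩ := scan_frame_input happ hend hf1
    have hlt : i < L.length := by
      by_contra h
      rw [Test.holds_lt, NatExp.eval, NatExp.eval, hp, hr, ← hE.limit_eq,
        show i = L.length by omega] at hb
      exact lt_irrefl _ hb
    refine (runs_enterApp ((arity_lt_length_flatMap (List.getElem_mem hlt)).le.trans hB)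
      (by simpa [hp, hq, hN, hR] using hE.stored i hlt)).seq fun s2 hf2 hAt => ?_
    have hp2 := (hf2.nat rPos rfl).trans hp
    have hq2 := (hf2.nat rTab rfl).trans hq
    have hf2' := hf1.trans (hf2.mono fun f hf => (scan_any hf).2.1)
    refine (step i hlt s2 hf2' hAt hp2 hq2 (hInv' hf2 (.inr (.inl rfl)) hI)).seq
      fun s3 hf3 hI3 => ?_
    refine (runs_leaveApp hlt (hAt.frame hf3 happ) ((hf3.nat rPos (by simp [hbody])).trans hp2)
      ((hf3.nat rTab (by simp [hbody])).trans hq2)).imp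
      fun s4 hf4 ⟨hp4, hq4⟩ => ⟨m - 1, by omega, i + 1, by omega,
      (hf2'.trans (hf3.mono fun f hf => (scan_any hf).2.2.1)).trans
        (hf4.mono fun f hf => (scan_any hf).2.2.2), hp4, hq4, hInv' hf4 (.inr (.inr rfl)) hI3⟩
  · rintro m s1 - ⟨i, hi, hf1, hp, -, hI⟩ hb
    rw [Test.holds_lt, NatExp.eval, NatExp.eval, hp, (scan_frame_input happ hend hf1).1,
      ← hE.limit_eq] at hb
    have : ¬ i < L.length := fun h => hb (natPos_lt_natPos_length _ h)
    rwa [show L.length = i by omega]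

/-- The number with the binary digits `b 0, …, b (i - 1)`, the most significant one first. -/
def hornerVal (b : ℕ → Bool) : ℕ → ℕ
  | 0 => 0
  | i + 1 => 2 * hornerVal b i + (b i).toNat

theorem hornerVal_lt (b : ℕ → Bool) (i : ℕ) : hornerVal b i < 2 ^ i := by
  induction i with
  | zero => simp [hornerVal]
  | succ i ih =>
    have := Bool.toNat_le (b i)
    rw [hornerVal, pow_succ]
    omega

theorem testBit_hornerVal (b : ℕ → Bool) {i j : ℕ} (h : j < i) :
    (hornerVal b i).testBit (i - 1 - j) = b j := by
  induction i with
  | zero => omega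
  | succ i ih =>
    have := Bool.toNat_le (b i)
    rcases Nat.lt_succ_iff_lt_or_eq.1 h with hj | rfl
    · rw [show i + 1 - 1 - j = (i - 1 - j) + 1 by omega, Nat.testBit_succ, ← ih hj, hornerVal]
      congr 1
      omega
    · rw [show j + 1 - 1 - j = 0 by omega, hornerVal, Nat.testBit_zero]
      cases b j <;> simp

theorem lexTuple_hornerVal (b : ℕ → Bool) (k : ℕ) :
    Constraint.lexTuple k (hornerVal b k) = fun i : Fin k => b i :=
  funext fun i => testBit_hornerVal b i.2

/-- Compute the place in the table of the application at work at which its value under the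
assignment is found. -/
def horner : Prog :=
  setN rIndex (.const 0) ;; forN rPlace (.reg rArity) (setN rIndex
    (.reg rIndex + .reg rIndex + .get aBits (.get 0 (.reg rPos + .const 1 + .reg rPlace))))

theorem runs_horner (b : ℕ → Bool) (hs : s.At a) (hB : a.con.arity ≤ B)
    (hb : ∀ i (h : i < a.con.arity), (s.natArr aBits).getD (a.vars ⟨i, h⟩) 0 = (b i).toNat) :
    Runs B horner s fun s' => s'.natReg rIndex = hornerVal b a.con.arity := by
  refine runs_instr_seq (runs_forN (fun i s' => s'.natReg rIndex = hornerVal b i) rfl hB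
    (fun s' hf => ?_) (by simp) (by simp [hornerVal]) fun i hi s' hf h5 h => runs_instr.2 ?_)
  · simp [hf.nat rArity rfl, hs.arity]
  · have := hb i hi
    rw [← hs.stored.vars i hi] at this
    simp [hf.nat rPos rfl, hf.natArr 0 rfl, hf.natArr aBits rfl, this, h5, h, hornerVal]
    omega

/-- Compute the measure of the assignment, in the real register `0`. -/
def evalTotal : Prog :=
  setR 0 (.const 1) ;;
    scan (horner ;; setR 0 (.mul (.reg 0) (.get 0 (.reg rTab + .reg rIndex))))

theorem runs_evalTotal (σ : ℕ → Bool)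
    (hE : Encodes L (s.natArr 0) (s.realArr 0) (s.natReg rStart) (s.natReg rEnd))
    (hB : (L.flatMap nats).length ≤ B)
    (hσ : ∀ v < n, (s.natArr aBits).getD v 0 = (σ v).toNat) :
    Runs B evalTotal s fun s' => s'.realReg 0 = total L σ := by
  refine runs_instr_seq ?_
  refine (runs_scan rfl rfl (by simpa using hE) hB
    (fun i s' => s'.realReg 0 = total (L.take i) σ) (fun i s s' hf h => ?_) (by simp [total])
    fun i hi s' hf hs _ _ hI => ?_).imp fun s' _ h => by simpa using h
  · rwa [hf.real 0 rfl]
  · have hk := (arity_lt_length_flatMap (List.getElem_mem hi)).le.trans hB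
    refine (runs_horner (padTuple fun j => σ (L[i].vars j)) hs hk fun j hj => ?_).seq
      fun s2 hf2 h6 => runs_instr.2 ?_
    · simp [hf.natArr aBits rfl, hσ, padTuple, hj]
    · have htable := hs.stored.table _ (hornerVal_lt (padTuple fun j => σ (L[i].vars j)) _)
      rw [lexTuple_hornerVal] at htable
      simp [hf2.real 0 rfl, hf2.realArr 0 rfl, hf2.nat rTab rfl, h6, htable, hI,
        total_take_succ hi, value, padTuple_val]

end RealRAM

namespace Application

variable {n : ℕ} {L : List (Application n)}

theorem total_padTuple (σ : Fin n → Bool) :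
    total L (padTuple σ) = (L.map fun a => a.value σ).prod := by
  simp only [total, padTuple_val]

end Application

namespace Word

theorem getD_pair_zero (w v : Word) : (w.pair v).nats.getD 0 0 = w.nats.length := rfl

theorem getD_pair_one (w v : Word) : (w.pair v).nats.getD 1 0 = w.reals.length := rfl

theorem getD_pair_right (w v : Word) (i : ℕ) :
    (w.pair v).nats.getD (w.nats.length + 2 + i) 0 = v.nats.getD i 0 := by
  rw [show w.nats.length + 2 + i = w.nats.length + i + 1 + 1 by omega, pair, List.getD_cons_succ,
    List.getD_cons_succ, List.getD_append_right _ _ _ _ (by omega), Nat.add_sub_cancel_left]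

end Word

namespace CSPInstance

open Application

variable {F : Set Constraint} (x : CSPInstance F)

theorem size_enc : x.enc.size = (x.apps.flatMap nats).length + 1 +
    (x.n + (x.apps.flatMap nats).sum) + (x.apps.flatMap fun a => a.con.table).length := rfl

theorem n_le_size : x.n ≤ x.enc.size := by
  rw [size_enc]
  omega

theorem getD_pair_two (v : Word) : (x.enc.pair v).nats.getD 2 0 = x.n := rfl

theorem encodes_enc : Encodes x.apps x.enc.nats x.enc.reals 1 x.enc.nats.length := by
  have h := encodes_append x.apps [x.n] [] []
  simp only [List.append_nil] at h
  rwa [Nat.add_comm] at h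

theorem encodes_pair (v : Word) :
    Encodes x.apps (x.enc.pair v).nats (x.enc.pair v).reals 3 (x.enc.nats.length + 2) := by
  have := encodes_append x.apps [x.enc.nats.length, x.enc.reals.length, x.n] v.nats v.reals
  convert this using 1
  · simp [enc, Word.pair]
  · simp only [enc, Word.pair]
  · rfl
  · simp only [enc, List.length_cons, List.length_nil]
    omega

theorem pair_shape_iff (v : Word) :
    (x.enc.pair v).reals.length ≤ (x.enc.pair v).nats.getD 1 0 ∧ (x.enc.pair v).nats.length =
        (x.enc.pair v).nats.getD 0 0 + 2 + (x.enc.pair v).nats.getD 2 0 ↔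
      v.reals = [] ∧ v.nats.length = x.n := by
  rw [Word.getD_pair_zero, Word.getD_pair_one, getD_pair_two, ← List.length_eq_zero_iff]
  simp only [Word.pair, List.length_cons, List.length_append]
  omega

end CSPInstance

namespace RealRAM

open Application

variable {B n : ℕ} {s : State} {L : List (Application n)}

/-! ## Decisions -/

open Classical in
/-- A truth value as a number. -/
def flag (p : Prop) : ℕ := if p then 1 else 0

theorem flag_of {p : Prop} (h : p) : flag p = 1 := if_pos h

theorem flag_of_not {p : Prop} (h : ¬ p) : flag p = 0 := if_neg h

theorem flag_eq_one {p : Prop} : flag p = 1 ↔ p := by simp [flag]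

/-- An instruction without effect. -/
def skip : Prog := setN rPlace (.reg rPlace)

theorem runs_skip {Q : State → Prop} (h : Q s) : Runs B skip s Q :=
  runs_instr.2 (by simpa using h)

/-- Clear the flag `f` unless the test `b` holds after `pre` for all values of the register `r` up
to the limit `e`. -/
def checkAll (r : ℕ) (e : NatExp) (pre : Prog) (b : Test) (f : ℕ) : Prog :=
  forN r e (pre ;; .ite b skip (setN f (.const 0)))

theorem runs_checkAll {r f N : ℕ} {e : NatExp} {pre : Prog} {b : Test} {p : Prop} {q : ℕ → Prop}
    (hrf : r ≠ f) (hr5 : r ≠ rPlace)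
    (hr : pre.writesNat r = false) (hf : pre.writesNat f = false) (hN : N ≤ B)
    (hp : s.natReg f = flag p)
    (he : ∀ s', Frame (checkAll r e pre b f) s s' → e.eval s' = N)
    (hq : ∀ i < N, ∀ s', Frame (checkAll r e pre b f) s s' → s'.natReg r = i →
      Runs B pre s' fun s'' => (b.Holds s'' ↔ q i)) :
    Runs B (checkAll r e pre b f) s fun s' => s'.natReg f = flag (p ∧ ∀ i < N, q i) := by
  refine runs_forN (fun i s' => s'.natReg f = flag (p ∧ ∀ j < i, q j)) ?_ hN he ?_ (by simpa) ?_
  · simp [Prog.any, skip, hr, hrf.symm, hr5.symm]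
  · simp +contextual [hrf.symm]
  · refine fun i hi s' hs' hi' h => (hq i hi s' hs' hi').seq fun s2 hf2 hb => ?_
    replace h := (hf2.nat f hf).trans h
    refine runs_ite (fun hb' => runs_skip ?_) fun hb' => runs_instr.2 ?_
    · simp only [Nat.forall_lt_succ_right, h, hb.1 hb', and_true]
    · rw [flag_of_not fun h' => hb' (hb.2 (h'.2 i (Nat.lt_succ_self i)))]
      simp

/-- Output the flag. -/
def answer : Prog :=
  .instr (.clearReal 0) ;; .instr (.clearNat 0) ;; .instr (.pushNat 0 (.reg rFlag))

theorem runs_answer {p : Prop} (h : s.natReg rFlag = flag p) :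
    Runs B answer s fun s' => (p → s'.output = Word.yes) ∧ (¬ p → s'.output = Word.no) := by
  refine runs_instr_seq (runs_instr_seq (runs_instr.2 ?_))
  constructor <;> intro hp
  · simp [State.output, Word.yes, h, flag_of hp]
  · simp [State.output, Word.no, h, flag_of_not hp]

/-! ## Recognition of solutions -/

/-- Decide whether the second component of a pair encodes an assignment for the first one. -/
def solutionProg : Prog :=
  setN rFlag (.const 1) ;;
  .ite (.and (.natLe (.realLen 0) (.get 0 (.const 1)))
      (.eq (.natLen 0) (.get 0 (.const 0) + .const 2 + .get 0 (.const 2))))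
    (checkAll rCount (.get 0 (.const 2)) skip
      (.natLe (.get 0 (.get 0 (.const 0) + .const 2 + .reg rCount)) (.const 1)) rFlag)
    (setN rFlag (.const 0)) ;;
  answer

theorem exists_encAssignment_iff (n : ℕ) (v : Word) :
    (∃ σ : Fin n → Bool, v = encAssignment σ) ↔
      (v.reals = [] ∧ v.nats.length = n) ∧ ∀ i < n, v.nats.getD i 0 ≤ 1 := by
  constructor
  · rintro ⟨σ, rfl⟩
    refine ⟨⟨rfl, by simp [encAssignment]⟩, fun i hi => ?_⟩
    simp [encAssignment, List.getD_eq_getElem?_getD, hi, Bool.toNat_le]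
  · obtain ⟨N, R⟩ := v
    rintro ⟨⟨rfl, rfl⟩, hle⟩
    refine ⟨fun i => N[i] == 1, ?_⟩
    simp only [encAssignment, Word.mk.injEq, and_true]
    refine List.ext_getElem (by simp) fun i hi _ => ?_
    have := hle i hi
    rw [List.getD_eq_getElem _ _ hi] at this
    simp only [List.getElem_ofFn]
    rcases Nat.le_one_iff_eq_zero_or_eq_one.1 this with h | h <;> simp [h]

theorem runs_solutionProg {F : Set Constraint} (x : CSPInstance F) (v : Word) (hB : x.n ≤ B) :
    Runs B solutionProg (State.init (x.enc.pair v)) fun s =>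
      ((∃ σ : Fin x.n → Bool, v = encAssignment σ) → s.output = Word.yes) ∧
      (¬ (∃ σ : Fin x.n → Bool, v = encAssignment σ) → s.output = Word.no) := by
  rw [exists_encAssignment_iff]
  refine runs_instr_seq (Runs.seq (runs_ite (fun h => ?_) fun h => ?_) fun s' _ => runs_answer)
  · refine (runs_checkAll (p := v.reals = [] ∧ v.nats.length = x.n) (by decide) (by decide)
      rfl rfl hB ?_ (fun s' hf => ?_) fun i _ s' hf hi => runs_skip ?_)
    · rw [flag_of ((x.pair_shape_iff v).1 (by
        simpa [Test.Holds, State.init, ← le_antisymm_iff] using h))]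
      simp
    · simp [hf.natArr 0 rfl, State.init, CSPInstance.getD_pair_two]
    · simp [Test.Holds, hf.natArr 0 rfl, State.init, hi, Word.getD_pair_zero, Word.getD_pair_right]
  · refine runs_instr.2 ?_
    rw [flag_of_not]
    · simp
    · rintro ⟨hv, -⟩
      apply h
      simpa [Test.Holds, State.init, ← le_antisymm_iff] using (x.pair_shape_iff v).2 hv

/-! ## Computation of the measure -/

/-- Compute the measure of a pair of an instance and an assignment. -/
def measureProg : Prog :=
  setN rStart (.const 3) ;; setN rEnd (.get 0 (.const 0) + .const 2) ;;
  forN rCount (.get 0 (.const 2)) (.instr (.pushNat aBits (.get 0 (.reg rEnd + .reg rCount)))) ;;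
  evalTotal ;; .instr (.clearNat 0) ;; .instr (.clearReal 0) ;; .instr (.pushReal 0 (.reg 0))

theorem getD_map_range {α : Type*} (f : ℕ → α) (d : α) {N i : ℕ} (h : i < N) :
    ((List.range N).map f).getD i d = f i := by
  rw [List.getD_eq_getElem _ _ (by simpa using h)]
  simp

theorem runs_measureProg {F : Set Constraint} (x : CSPInstance F) (σ : Fin x.n → Bool)
    (hB : x.enc.size ≤ B) : Runs B measureProg (State.init (x.enc.pair (encAssignment σ))) fun s =>
      s.output = ⟨[], [(((x.apps.map fun a => a.value σ).prod : ℝ≥0) : ℝ)]⟩ := by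
  rw [x.size_enc] at hB
  refine runs_instr_seq (runs_instr_seq ((runs_forN
    (fun i s' => s'.natArr aBits = (List.range i).map fun v => (padTuple σ v).toNat) rfl
    (by omega : x.n ≤ B) (fun s' hf => ?_) (by simp) (by simp [State.init])
    fun i hi s' hf h16 hA => runs_instr.2 ?_).seq fun s1 hf1 hA =>
      (runs_evalTotal (L := x.apps) (padTuple σ) ?_ (by omega) ?_).seq fun s2 _ h =>
        runs_instr_seq (runs_instr_seq (runs_instr.2 ?_))))
  · simp [hf.natArr 0 rfl, State.init, CSPInstance.getD_pair_two]
  · have hbit : (encAssignment σ).nats.getD i 0 = (padTuple σ i).toNat := by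
      simp [encAssignment, List.getD_eq_getElem?_getD, hi, padTuple]
    simp [hf.nat rEnd rfl, hf.natArr 0 rfl, State.init, h16, hA, Word.getD_pair_zero,
      Word.getD_pair_right, hbit, List.range_succ]
  · simpa [hf1.natArr 0 rfl, hf1.realArr 0 rfl, hf1.nat rStart rfl, hf1.nat rEnd rfl, State.init,
      Word.getD_pair_zero] using x.encodes_pair (encAssignment σ)
  · intro v hv
    rw [hA, getD_map_range _ _ hv]
  · simp [State.output, h, total_padTuple]

end RealRAM

section Problem

open RealRAM

variable (F : Set Constraint)

theorem mem_solutions_iff (x : CSPInstance F) (v : Word) :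
    (∃ (x' : CSPInstance F) (y : Fin x'.n → Bool), x.enc.pair v = x'.enc.pair (encAssignment y)) ↔
      ∃ σ : Fin x.n → Bool, v = encAssignment σ := by
  constructor
  · rintro ⟨x', y, h⟩
    obtain ⟨hx, hv⟩ := Word.pair_injective h
    obtain rfl := CSPInstance.enc_injective F hx
    exact ⟨y, hv⟩
  · rintro ⟨σ, rfl⟩
    exact ⟨x, σ, rfl⟩

theorem CSPInstance.size_le_size_pair (x : CSPInstance F) (v : Word) :
    x.enc.size ≤ (x.enc.pair v).size := by
  simp only [Word.size, Word.pair, List.length_cons, List.length_append, List.sum_cons,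
    List.sum_append]
  omega

theorem maxProdCSP_solutionsRecognizable : (maxProdCSP F).SolutionsRecognizable := by
  obtain ⟨p, hp⟩ := solutionProg.exists_cost_poly
  refine ⟨solutionProg, p, ?_⟩
  rintro w ⟨x, v, rfl⟩
  have hB : x.n ≤ (x.enc.pair v).size := x.n_le_size.trans (x.size_le_size_pair F v)
  have h := runs_solutionProg x v hB
  have hiff := mem_solutions_iff F x v
  rw [hp]
  exact ⟨fun hs => (h.imp fun s _ h => h.1 (hiff.1 hs)).yields le_rfl,
    fun hs => (h.imp fun s _ h => h.2 fun hσ => hs (hiff.2 hσ)).yields le_rfl⟩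

theorem maxProdCSP_solutionsBounded : (maxProdCSP F).SolutionsBounded := by
  refine ⟨2 * Polynomial.X, fun x σ => ?_⟩
  have hones : (List.ofFn fun i => (σ i).toNat).sum ≤ x.n := by
    rw [List.sum_ofFn]
    refine (Finset.sum_le_card_nsmul _ _ 1 fun i _ => Bool.toNat_le _).trans ?_
    rw [smul_eq_mul, mul_one, Finset.card_univ]
    exact (Fintype.card_fin _).le
  have hsol : ((maxProdCSP F).encSol x σ).size = x.n + (List.ofFn fun i => (σ i).toNat).sum := by
    simp only [Word.size, maxProdCSP, encAssignment, List.length_ofFn, List.length_nil, add_zero]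
  have hinst : x.n ≤ ((maxProdCSP F).encInst x).size := CSPInstance.n_le_size x
  rw [hsol]
  simp only [Polynomial.eval_mul, Polynomial.eval_ofNat, Polynomial.eval_X]
  omega

theorem maxProdCSP_measureComputable : (maxProdCSP F).MeasureComputable := by
  obtain ⟨p, hp⟩ := measureProg.exists_cost_poly
  exact ⟨measureProg, p, fun x σ =>
    (runs_measureProg x σ (x.size_le_size_pair F _)).yields (hp _).ge⟩

end Problem

namespace RealRAM

open Application

variable {B n : ℕ} {s s' : State} {a : Application n} {L : List (Application n)}
  {lab : Labelling} {σ : ℕ → Bool}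

/-! ## Classes of variables in memory -/

/-- The arrays hold the labels and the values of the variables `0, …, n`. -/
structure Represents (n : ℕ) (s : State) (lab : Labelling) (σ : ℕ → Bool) : Prop where
  lab : s.natArr aLabels = (List.range (n + 1)).map lab
  val : s.natArr aBits = (List.range (n + 1)).map fun v => (σ v).toNat

theorem Represents.congr (h : Represents n s lab σ) (hlab : s'.natArr aLabels = s.natArr aLabels)
    (hval : s'.natArr aBits = s.natArr aBits) : Represents n s' lab σ :=
  ⟨hlab.trans h.lab, hval.trans h.val⟩

theorem Represents.getD_lab (h : Represents n s lab σ) {v : ℕ} (hv : v ≤ n) :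
    (s.natArr aLabels).getD v 0 = lab v := by
  rw [h.lab, getD_map_range _ _ (Nat.lt_succ_of_le hv)]

theorem Represents.getD_val (h : Represents n s lab σ) {v : ℕ} (hv : v ≤ n) :
    (s.natArr aBits).getD v 0 = (σ v).toNat := by
  rw [h.val, getD_map_range _ _ (Nat.lt_succ_of_le hv)]

/-- The values of `f` below `i`, and those of `g` from `i` on: the state of a table of `g` that is
being overwritten by one of `f`. -/
def splice (f g : ℕ → ℕ) (i v : ℕ) : ℕ := if v < i then f v else g v

theorem splice_zero (f g : ℕ → ℕ) : splice f g 0 = g := funext fun _ => if_neg (Nat.not_lt_zero _)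

theorem splice_self (f g : ℕ → ℕ) (i : ℕ) : splice f g i i = g i := if_neg (lt_irrefl i)

theorem splice_succ {f g : ℕ → ℕ} {i : ℕ} (h : f i = g i) :
    splice f g (i + 1) = splice f g i := by
  grind [splice]

theorem set_map_splice (f g : ℕ → ℕ) (N i : ℕ) :
    ((List.range N).map (splice f g i)).set i (f i) =
      (List.range N).map (splice f g (i + 1)) := by
  refine List.ext_getElem (by simp) fun v h1 h2 => ?_
  simp only [List.getElem_set, List.getElem_map, List.getElem_range]
  grind [splice]

theorem map_splice_length (f g : ℕ → ℕ) (N : ℕ) :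
    (List.range N).map (splice f g N) = (List.range N).map f :=
  List.map_congr_left fun _ hv => if_pos (List.mem_range.1 hv)

/-- The sum modulo `2` of two bits. -/
abbrev NatExp.xor (e₁ e₂ : NatExp) : NatExp := (e₁ - e₂) + (e₂ - e₁)

theorem NatExp.eval_xor {e₁ e₂ : NatExp} {b₁ b₂ : Bool} (h₁ : e₁.eval s = b₁.toNat)
    (h₂ : e₂.eval s = b₂.toNat) : (NatExp.xor e₁ e₂).eval s = (b₁ ^^ b₂).toNat := by
  rw [NatExp.eval_add, NatExp.eval_sub, NatExp.eval_sub, h₁, h₂]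
  cases b₁ <;> cases b₂ <;> rfl

/-- Merge the old class into the new one and add the bit to its values. -/
def relabelProg : Prog :=
  forN rCount (.reg rVars + .const 1) (.ite (.eq (.get aLabels (.reg rCount)) (.reg rOld))
    (.instr (.writeNat aLabels (.reg rCount) (.reg rNew)) ;;
      .instr (.writeNat aBits (.reg rCount) (.xor (.get aBits (.reg rCount)) (.reg rBit))))
    skip)

theorem runs_relabelProg {c c' : ℕ} {d : Bool} (hB : n + 1 ≤ B)
    (hr : Represents n s lab σ) (hn : s.natReg rVars = n) (hc : s.natReg rOld = c)
    (hc' : s.natReg rNew = c') (hd : s.natReg rBit = d.toNat) :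
    Runs B relabelProg s fun s' =>
      Represents n s' (lab.merge c c') (lab.flip (fun x => x == c && d) σ) := by
  set lab' := lab.merge c c'
  set val : ℕ → ℕ := fun v => (σ v).toNat with hval
  set val' : ℕ → ℕ := fun v => (lab.flip (fun x => x == c && d) σ v).toNat with hval'
  refine Runs.imp (runs_forN (fun i s' =>
      s'.natArr aLabels = (List.range (n + 1)).map (splice lab' lab i) ∧
        s'.natArr aBits = (List.range (n + 1)).map (splice val' val i)) rfl hB
    (fun s' hf => by simp [hf.nat rVars rfl, hn]) (fun _ _ _ h => h)
    (by simpa only [splice_zero] using ⟨hr.lab, hr.val⟩)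
    fun i hi s' hf h16 ⟨hA, hA'⟩ => ?_) fun s' _ h =>
      ⟨h.1.trans (map_splice_length ..), h.2.trans (map_splice_length ..)⟩
  have hlabi : (s'.natArr aLabels).getD i 0 = lab i := by
    rw [hA, getD_map_range _ _ hi, splice_self]
  have hvali : (s'.natArr aBits).getD i 0 = (σ i).toNat := by
    rw [hA', getD_map_range _ _ hi, splice_self]
  refine runs_ite (fun h => runs_instr_seq (runs_instr.2 ?_)) fun h => runs_skip ?_
  · replace h : lab i = c := by simpa [hlabi, h16, hf.nat rOld rfl, hc] using h
    have hxor := NatExp.eval_xor (s := s') (e₁ := .get aBits (.reg rCount)) (e₂ := .reg rBit)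
      (by simpa [h16] using hvali) ((hf.nat rBit rfl).trans hd)
    have hlab'i : lab' i = c' := if_pos h
    have hval'i : val' i = (σ i ^^ d).toNat := by simp [hval', Labelling.flip, h]
    exact ⟨by simp [hA, ← set_map_splice, hlab'i, h16, hf.nat rNew rfl, hc'],
      by simp [hA', ← set_map_splice, hval'i, h16, ← hxor]⟩
  · replace h : lab i ≠ c := by simpa [hlabi, h16, hf.nat rOld rfl, hc] using h
    exact ⟨hA.trans (by rw [splice_succ]; exact if_neg h),
      hA'.trans (by rw [splice_succ]; simp [hval', hval, Labelling.flip, beq_eq_false_iff_ne.2 h])⟩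

/-! ## Search for ties -/

/-- Compute the bits of the place in the table of the application at work. -/
def decode : Prog :=
  .instr (.clearNat aRow) ;; setN rRest (.reg rIndex) ;; forN rPlace (.reg rArity)
    (setN rRest (.reg rRest + .reg rRest) ;; .ite (.natLe (.reg rSize) (.reg rRest))
      (.instr (.pushNat aRow (.const 1)) ;; setN rRest (.reg rRest - .reg rSize))
      (.instr (.pushNat aRow (.const 0))))

theorem two_pow_mul_mod_pow_succ (m i j : ℕ) :
    2 ^ i * (m % 2 ^ (j + 1)) + 2 ^ i * (m % 2 ^ (j + 1)) =
      2 ^ (i + 1) * (m % 2 ^ j) + if m.testBit j then 2 ^ (i + j + 1) else 0 := by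
  have h : m % 2 ^ (j + 1) = m % 2 ^ j + 2 ^ j * (m / 2 ^ j % 2) := Nat.mod_pow_succ
  rw [h, Nat.testBit_eq_decide_div_mod_eq]
  rcases Nat.mod_two_eq_zero_or_one (m / 2 ^ j) with h | h <;>
    simp only [h, zero_ne_one, decide_false, decide_true, Bool.false_eq_true, if_false, if_true] <;>
    ring

theorem two_pow_mul_mod_lt (m i j : ℕ) : 2 ^ (i + 1) * (m % 2 ^ j) < 2 ^ (i + j + 1) := by
  rw [add_right_comm, pow_add 2 (i + 1)]
  exact Nat.mul_lt_mul_of_pos_left (Nat.mod_lt _ (by positivity)) (by positivity)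

theorem runs_decode {m : ℕ} (hs : s.At a) (hB : a.con.arity ≤ B) (h6 : s.natReg rIndex = m)
    (hm : m < 2 ^ a.con.arity) :
    Runs B decode s fun s' => s'.natArr aRow =
      (List.range a.con.arity).map fun i => (m.testBit (a.con.arity - 1 - i)).toNat := by
  obtain ⟨-, hk, hsize⟩ := hs
  generalize a.con.arity = k at *
  refine runs_instr_seq (runs_instr_seq (Runs.imp (runs_forN (fun i s' =>
      s'.natReg rRest = 2 ^ i * (m % 2 ^ (k - i)) ∧
        s'.natArr aRow = (List.range i).map fun i => (m.testBit (k - 1 - i)).toNat) rfl hB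
    (fun s' hf => by simp [hf.nat rArity rfl, hk]) (by simp)
    (by simp [h6, Nat.mod_eq_of_lt hm]) fun i hi s' hf _ ⟨hrest, hrow⟩ => ?_) fun _ _ h => h.2))
  have h4 : s'.natReg rSize = 2 ^ k := by simp [hf.nat rSize rfl, hsize]
  obtain ⟨j, rfl⟩ : ∃ j, k = i + j + 1 := ⟨k - i - 1, by omega⟩
  rw [show i + j + 1 - i = j + 1 by omega] at hrest
  have hdouble := two_pow_mul_mod_pow_succ m i j
  have hlt := two_pow_mul_mod_lt m i j
  have hj : i + j + 1 - (i + 1) = j := by omega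
  have hj' : i + j - i = j := by omega
  cases hb : m.testBit j with
  | true =>
    refine runs_instr_seq (runs_ite (fun _ => runs_instr_seq (runs_instr.2 ?_)) fun h => ?_)
    · simp [h4, hrest, hrow, List.range_succ, hb, hdouble, hj, hj']
    · simp [Test.Holds, h4, hrest, hb, hdouble] at h
  | false =>
    refine runs_instr_seq (runs_ite (fun h => ?_) fun _ => runs_instr.2 ?_)
    · simp [Test.Holds, h4, hrest, hb, hdouble, hlt.not_ge] at h
    · simp [hrest, hrow, List.range_succ, hb, hdouble, hj, hj']

theorem getD_bits (k m x : ℕ) :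
    ((List.range k).map fun i => (m.testBit (k - 1 - i)).toNat).getD x 0 =
      (padTuple (Constraint.lexTuple k m) x).toNat := by
  by_cases hx : x < k
  · rw [getD_map_range _ _ hx, padTuple_of_lt _ hx, Constraint.lexTuple]
  · rw [List.getD_eq_default _ _ (by simpa using hx)]
    simp [padTuple, hx]

theorem tied_iff_lexTuple (a : Application n) (x y : ℕ) (e : Bool) :
    a.Tied x y e ↔ ∀ m < 2 ^ a.con.arity,
      a.con.val (Constraint.lexTuple a.con.arity m) ≠ 0 →
        (padTuple (Constraint.lexTuple a.con.arity m) x ^^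
          padTuple (Constraint.lexTuple a.con.arity m) y) = e := by
  refine ⟨fun h m _ => h _, fun h z => ?_⟩
  obtain ⟨m, rfl⟩ := Constraint.lexTuple_surjective _ z
  exact h m m.2

/-- Decide whether the places `rX` and `rY` of the application at work are tied with sum `e`. -/
def detectTie (e : Bool) : Prog :=
  setN rFlag (.const 1) ;; checkAll rIndex (.reg rSize) decode
    (.not (.and (.not (.realEq (.get 0 (.reg rTab + .reg rIndex)) (.const 0)))
      (.not (.eq (.xor (.get aRow (.reg rX)) (.get aRow (.reg rY))) (.const e.toNat))))) rFlag

theorem runs_detectTie (e : Bool) (hs : s.At a) (hB : a.con.arity ≤ B)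
    (hB' : 2 ^ a.con.arity ≤ B) :
    Runs B (detectTie e) s fun s' =>
      s'.natReg rFlag = flag (a.Tied (s.natReg rX) (s.natReg rY) e) := by
  simp only [tied_iff_lexTuple]
  refine runs_instr_seq (Runs.imp (runs_checkAll (p := True) (by decide) (by decide) rfl rfl hB'
    (by simp [flag_of]) (fun s' hf => by simp [hf.nat rSize rfl, hs.size])
    fun m hm s' hf h6 => (runs_decode (a := a) ?_ hB h6 hm).imp fun s2 hf2 hrow => ?_)
    fun s' _ h => by simpa only [true_and] using h)
  · exact (hs.frame (Frame.exec _ s) rfl).frame hf rfl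
  · have hs2 : s2.At a := ((hs.frame (Frame.exec _ s) rfl).frame hf rfl).frame hf2 rfl
    have hrow' (r : ℕ) : (NatExp.get aRow (.reg r)).eval s2 =
        (padTuple (Constraint.lexTuple a.con.arity m) (s2.natReg r)).toNat := by
      simp [hrow, getD_bits]
    have hX : s2.natReg rX = s.natReg rX := by simp [hf2.nat rX rfl, hf.nat rX rfl]
    have hY : s2.natReg rY = s.natReg rY := by simp [hf2.nat rY rfl, hf.nat rY rfl]
    have htoNat {b c : Bool} : b.toNat = c.toNat ↔ b = c := by cases b <;> cases c <;> simp
    rw [Test.Holds, Test.Holds, Test.Holds, Test.Holds, Test.holds_realEq, Test.holds_eq,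
      NatExp.eval_xor (hrow' rX) (hrow' rY), hX, hY, NatExp.eval, htoNat]
    simp [hf2.nat rIndex rfl, h6, hs2.stored.table m hm]

/-- The memory holds a labelling that is sound for the support of `L` and identifies the pairs
in `C`. -/
def TieInv (L : List (Application n)) (C : ℕ → ℕ → Prop) (s : State) : Prop :=
  ∃ lab σ, Represents n s lab σ ∧ Labelling.Sound (support L) lab σ ∧ ∀ u v, C u v → lab u = lab v

theorem TieInv.mono {C C' : ℕ → ℕ → Prop} (h : TieInv L C s) (hC : ∀ u v, C' u v → C u v) :
    TieInv L C' s := by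
  obtain ⟨lab, σ, h1, h2, h3⟩ := h
  exact ⟨lab, σ, h1, h2, fun u v huv => h3 u v (hC u v huv)⟩

theorem TieInv.congr {C : ℕ → ℕ → Prop} (h : TieInv L C s)
    (h1 : s'.natArr aLabels = s.natArr aLabels) (h2 : s'.natArr aBits = s.natArr aBits) :
    TieInv L C s' := by
  obtain ⟨lab, σ, hr, h3⟩ := h
  exact ⟨lab, σ, hr.congr h1 h2, h3⟩

/-- Merge the classes of the variables `rU` and `rV`, whose values have the sum `e`. -/
def mergeProg (e : Bool) : Prog :=
  setN rOld (.get aLabels (.reg rU)) ;; setN rNew (.get aLabels (.reg rV)) ;;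
  setN rBit (.xor (.get aBits (.reg rU)) (.get aBits (.reg rV))) ;;
  setN rBit (.xor (.reg rBit) (.const e.toNat)) ;; relabelProg

theorem runs_mergeProg {u v : ℕ} {e : Bool} {C : ℕ → ℕ → Prop} (hB : n + 1 ≤ B)
    (hn : s.natReg rVars = n) (hu : u ≤ n) (hv : v ≤ n) (hU : s.natReg rU = u)
    (hV : s.natReg rV = v) (he : ∀ τ ∈ support L, (τ u ^^ τ v) = e) (hI : TieInv L C s) :
    Runs B (mergeProg e) s (TieInv L fun u' v' => C u' v' ∨ u' = u ∧ v' = v) := by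
  obtain ⟨lab, σ, hr, hs, hC⟩ := hI
  have hbit := NatExp.eval_xor (s := s) (e₁ := .get aBits (.reg rU)) (e₂ := .get aBits (.reg rV))
    (by simpa [hU] using hr.getD_val hu) (by simpa [hV] using hr.getD_val hv)
  refine runs_instr_seq (runs_instr_seq (runs_instr_seq (runs_instr_seq ((runs_relabelProg
    (c := lab u) (c' := lab v) (d := (σ u ^^ σ v ^^ e)) (lab := lab) (σ := σ) hB
    (hr.congr ?_ ?_) ?_ ?_ ?_ ?_).imp fun s' _ hr' => ⟨_, _, hr', hs.merge he, ?_⟩))))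
  · simp
  · simp
  · simp [hn]
  · simpa [hU] using hr.getD_lab hu
  · simpa [hV] using hr.getD_lab hv
  · refine NatExp.eval_xor (b₁ := (σ u ^^ σ v)) ?_ rfl
    simpa using hbit
  · rintro u' v' (h | ⟨rfl, rfl⟩)
    · simp only [Labelling.merge, hC u' v' h]
    · simp [Labelling.merge]

/-- If the places `rX` and `rY` are tied with sum `e`, merge the classes of their variables. -/
def tieProg (e : Bool) : Prog :=
  detectTie e ;; .ite (.eq (.reg rFlag) (.const 1)) (mergeProg e) skip

theorem runs_tieProg {x y : ℕ} (e : Bool) {C : ℕ → ℕ → Prop} (ha : a ∈ L) (hs : s.At a)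
    (hB : n + 1 ≤ B) (hB' : a.con.arity ≤ B) (hB'' : 2 ^ a.con.arity ≤ B)
    (hn : s.natReg rVars = n) (hx : s.natReg rX = x) (hy : s.natReg rY = y)
    (hU : s.natReg rU = a.varAt x) (hV : s.natReg rV = a.varAt y) (hI : TieInv L C s) :
    Runs B (tieProg e) s (TieInv L fun u v =>
      C u v ∨ a.Tied x y e ∧ u = a.varAt x ∧ v = a.varAt y) := by
  refine (runs_detectTie e hs hB' hB'').seq fun s1 hf h8 => ?_
  rw [hx, hy] at h8
  replace hI : TieInv L C s1 := hI.congr (hf.natArr aLabels rfl) (hf.natArr aBits rfl)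
  by_cases ht : a.Tied x y e
  · rw [flag_of ht] at h8
    refine runs_ite (fun _ => (runs_mergeProg hB ((hf.nat rVars rfl).trans hn) (a.varAt_le x)
      (a.varAt_le y) ((hf.nat rU rfl).trans hU) ((hf.nat rV rfl).trans hV)
      (fun τ hτ => Tied.apply hτ ha ht) hI).imp fun s' _ hI => ?_) fun h => ?_
    · simpa only [ht, true_and] using hI
    · simp [h8] at h
  · rw [flag_of_not ht] at h8
    refine runs_ite (fun h => ?_) fun _ => runs_skip ?_
    · simp [h8] at h
    · simpa only [ht, false_and, or_false] using hI

/-- Put the variable at the place in the register `r` into the register `r'`. -/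
def loadVar (r r' : ℕ) : Prog :=
  .ite (.lt (.reg r) (.reg rArity)) (setN r' (.get 0 (.reg rPos + .const 1 + .reg r)))
    (setN r' (.reg rVars))

theorem runs_loadVar (r r' : ℕ) (hs : s.At a) (hn : s.natReg rVars = n) :
    Runs B (loadVar r r') s fun s' => s'.natReg r' = a.varAt (s.natReg r) := by
  rw [hs.stored.varAt_eq, ← hs.arity, ← hn]
  refine runs_ite (fun h => runs_instr.2 ?_) fun h => runs_instr.2 ?_ <;>
  · rw [Test.holds_lt] at h
    simp only [NatExp.eval] at h
    simp [h]

/-- Process the pair of places `rX` and `rY`. -/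
def pairProg : Prog :=
  loadVar rX rU ;; loadVar rY rV ;; tieProg false ;; tieProg true

theorem runs_pairProg {x y : ℕ} {C : ℕ → ℕ → Prop} (ha : a ∈ L) (hs : s.At a)
    (hB : n + 1 ≤ B) (hB' : a.con.arity ≤ B) (hB'' : 2 ^ a.con.arity ≤ B)
    (hn : s.natReg rVars = n) (hx : s.natReg rX = x) (hy : s.natReg rY = y) (hI : TieInv L C s) :
    Runs B pairProg s (TieInv L fun u v =>
      C u v ∨ ∃ e, a.Tied x y e ∧ u = a.varAt x ∧ v = a.varAt y) := by
  refine (runs_loadVar _ _ hs hn).seq fun s1 hf1 hU1 => ?_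
  have hs1 := hs.frame hf1 rfl
  have hn1 := (hf1.nat rVars rfl).trans hn
  refine (runs_loadVar _ _ hs1 hn1).seq fun s2 hf2 hV2 => ?_
  have hs2 := hs1.frame hf2 rfl
  have hn2 := (hf2.nat rVars rfl).trans hn1
  have hx2 : s2.natReg rX = x := by rw [hf2.nat rX rfl, hf1.nat rX rfl, hx]
  have hy2 : s2.natReg rY = y := by rw [hf2.nat rY rfl, hf1.nat rY rfl, hy]
  have hU2 : s2.natReg rU = a.varAt x := by rw [hf2.nat rU rfl, hU1, hx]
  replace hV2 : s2.natReg rV = a.varAt y := by rw [hV2, hf1.nat rY rfl, hy]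
  have hI2 : TieInv L C s2 := (hI.congr (hf1.natArr aLabels rfl) (hf1.natArr aBits rfl)).congr
    (hf2.natArr aLabels rfl) (hf2.natArr aBits rfl)
  refine (runs_tieProg false ha hs2 hB hB' hB'' hn2 hx2 hy2 hU2 hV2 hI2).seq fun s3 hf3 hI3 => ?_
  refine (runs_tieProg true ha (hs2.frame hf3 rfl) hB hB' hB'' ((hf3.nat rVars rfl).trans hn2)
    ((hf3.nat rX rfl).trans hx2) ((hf3.nat rY rfl).trans hy2) ((hf3.nat rU rfl).trans hU2)
    ((hf3.nat rV rfl).trans hV2) hI3).imp fun s4 _ hI4 => hI4.mono ?_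
  simp only [Bool.exists_bool, or_assoc]
  exact fun _ _ h => h

/-- Process all pairs of places of the application at work. -/
def pairsProg : Prog :=
  forN rX (.reg rArity + .const 1) (forN rY (.reg rArity + .const 1) pairProg)

theorem runs_pairsProg {C : ℕ → ℕ → Prop} (ha : a ∈ L) (hs : s.At a) (hB : n + 1 ≤ B)
    (hB' : a.con.arity + 1 ≤ B) (hB'' : 2 ^ a.con.arity ≤ B) (hn : s.natReg rVars = n)
    (hI : TieInv L C s) :
    Runs B pairsProg s (TieInv L fun u v => C u v ∨ ∃ x ≤ a.con.arity, ∃ y ≤ a.con.arity,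
      ∃ e, a.Tied x y e ∧ u = a.varAt x ∧ v = a.varAt y) := by
  simp only [← Nat.lt_succ_iff]
  refine runs_forN (fun i => TieInv L fun u v => C u v ∨ ∃ x < i, ∃ y < a.con.arity + 1,
      ∃ e, a.Tied x y e ∧ u = a.varAt x ∧ v = a.varAt y) rfl hB'
    (fun s' hf => by simp [hf.nat rArity rfl, hs.arity]) (fun _ _ _ h => h.congr rfl rfl)
    (hI.mono (by simp)) fun i _ s1 hf1 hX hI1 => ?_
  have hs1 := hs.frame hf1 rfl
  refine Runs.imp (runs_forN (fun j => TieInv L fun u v => (C u v ∨ ∃ x < i,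
        ∃ y < a.con.arity + 1, ∃ e, a.Tied x y e ∧ u = a.varAt x ∧ v = a.varAt y) ∨
        ∃ y < j, ∃ e, a.Tied i y e ∧ u = a.varAt i ∧ v = a.varAt y) rfl hB'
      (fun s' hf => by simp [hf.nat rArity rfl, hs1.arity]) (fun _ _ _ h => h.congr rfl rfl)
      (hI1.mono (by simp)) fun j _ s2 hf2 hY hI2 => ?_) fun s' _ h => h.mono ?_
  · refine (runs_pairProg ha (hs1.frame hf2 rfl) hB (Nat.le_of_succ_le hB') hB''
      (by rw [hf2.nat rVars rfl, hf1.nat rVars rfl, hn]) ((hf2.nat rX rfl).trans hX) hY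
      hI2).imp fun s3 _ h => h.mono ?_
    simp only [Nat.exists_lt_succ_right, ← or_assoc]
    exact fun _ _ h => h
  · simp only [Nat.exists_lt_succ_right, ← or_assoc]
    exact fun _ _ h => h

/-- The memory holds an instance with the applications `L`. -/
structure State.HasInput (s : State) (L : List (Application n)) : Prop where
  vars : s.natReg rVars = n
  apps : Encodes L (s.natArr 0) (s.realArr 0) (s.natReg rStart) (s.natReg rEnd)

theorem State.HasInput.frame {c : Prog} (h : s.HasInput L) (hf : Frame c s s')
    (hc : (c.writesNat rVars || c.writesNat rStart || c.writesNat rEnd || c.writesNatArr 0 ||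
      c.writesRealArr 0) = false) : s'.HasInput L := by
  simp only [Bool.or_eq_false_iff] at hc
  obtain ⟨⟨⟨⟨h1, h2⟩, h3⟩, h4⟩, h5⟩ := hc
  refine ⟨(hf.nat _ h1).trans h.vars, ?_⟩
  rw [hf.nat _ h2, hf.nat _ h3, hf.natArr _ h4, hf.realArr _ h5]
  exact h.apps

/-- Identify tied variables for all applications. -/
def tiesProg : Prog := scan pairsProg

theorem runs_tiesProg (hs : s.HasInput L)
    (hB : n + 1 + (L.flatMap nats).length + (L.flatMap fun a => a.con.table).length ≤ B)
    (hI : TieInv L (fun _ _ => False) s) :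
    Runs B tiesProg s fun s' =>
      ∃ lab σ, Represents n s' lab σ ∧ lab.Sound (support L) σ ∧ TiesIdentified L lab := by
  refine Runs.imp (runs_scan rfl rfl hs.apps (by omega)
    (fun i => TieInv L fun u v => ∃ a ∈ L.take i, ∃ x ≤ a.con.arity, ∃ y ≤ a.con.arity,
      ∃ e, a.Tied x y e ∧ u = a.varAt x ∧ v = a.varAt y)
    (fun _ _ _ hf h => h.congr (hf.natArr aLabels rfl) (hf.natArr aBits rfl))
    (hI.mono (by simp)) fun i hi s1 hf1 hs1 _ _ hI1 => ?_) fun s' _ h => ?_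
  · have ha := List.getElem_mem hi
    have harity := arity_lt_length_flatMap ha
    have hpow := two_pow_le_length_flatMap ha
    refine (runs_pairsProg ha hs1 (by omega) (by omega) (by omega)
      ((hf1.nat rVars rfl).trans hs.vars) hI1).imp fun s2 _ hI2 => hI2.mono ?_
    simp only [List.take_succ_eq_append_getElem hi, List.mem_append, List.mem_singleton,
      or_and_right, exists_or, exists_eq_left]
    exact fun _ _ h => h
  · obtain ⟨lab, σ, hr, hS, hC⟩ := h
    rw [List.take_length] at hC
    exact ⟨lab, σ, hr, hS, fun a ha x hx y hy e h => hC _ _ ⟨a, ha, x, hx, y, hy, e, h, rfl, rfl⟩⟩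

/-! ## Greedy improvement -/

/-- Flip the class of the variable `rVar`. -/
def flipProg : Prog :=
  setN rOld (.get aLabels (.reg rVar)) ;; setN rNew (.reg rOld) ;; setN rBit (.const 1) ;;
  relabelProg

theorem runs_flipProg {v : ℕ} (hB : n + 1 ≤ B) (hn : s.natReg rVars = n) (hv : v ≤ n)
    (hV : s.natReg rVar = v) (hr : Represents n s lab σ) :
    Runs B flipProg s fun s' => Represents n s' lab (lab.flip (fun c => c == lab v) σ) := by
  have hlab := hr.getD_lab hv
  refine runs_instr_seq (runs_instr_seq (runs_instr_seq (Runs.imp (runs_relabelProg (c := lab v)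
    (c' := lab v) (d := true) (lab := lab) (σ := σ) hB (hr.congr ?_ ?_) ?_ ?_ ?_ ?_)
    fun s' _ h => ?_)))
  · simp
  · simp
  · simp [hn]
  · simpa [hV] using hlab
  · simpa [hV] using hlab
  · simp
  · simpa only [Labelling.merge_self, Bool.and_true] using h

/-- Flip every class once, and flip it back if that was no improvement. -/
def improveProg : Prog :=
  forN rVar (.reg rVars) (evalTotal ;; setR 1 (.reg 0) ;; flipProg ;; evalTotal ;;
    .ite (.realLe (.reg 1) (.reg 0)) skip flipProg)

/-- The memory holds an assignment that is best among those that arise from it by flipping classes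
of variables below `v`, provided that there are assignments of nonzero measure. -/
def GreedyInv (L : List (Application n)) (lab : Labelling) (v : ℕ) (s : State) : Prop :=
  ∃ σ, Represents n s lab σ ∧ ((support L).Nonempty →
    lab.Sound (support L) σ ∧ total L σ ≠ 0 ∧ lab.BestBelow (total L) σ v)

theorem runs_improveStep {v : ℕ} (hf : lab.FlipsIndependent (total L)) (hs : s.HasInput L)
    (hB : n + 1 + (L.flatMap nats).length ≤ B) (hv : v < n) (hV : s.natReg rVar = v)
    (hI : GreedyInv L lab v s) :
    Runs B (evalTotal ;; setR 1 (.reg 0) ;; flipProg ;; evalTotal ;;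
      .ite (.realLe (.reg 1) (.reg 0)) skip flipProg) s (GreedyInv L lab (v + 1)) := by
  obtain ⟨σ, hr, hσ⟩ := hI
  refine (runs_evalTotal σ hs.apps (by omega) fun w hw => hr.getD_val hw.le).seq
    fun s1 hf1 hold => runs_instr_seq ?_
  have hcopy := Frame.exec (.setReal 1 (.reg 0)) s1
  have hs1 := (hs.frame hf1 rfl).frame hcopy rfl
  have hV1 := (hcopy.nat rVar rfl).trans ((hf1.nat rVar rfl).trans hV)
  have hr1 := (hr.congr (hf1.natArr aLabels rfl) (hf1.natArr aBits rfl)).congr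
    (hcopy.natArr aLabels rfl) (hcopy.natArr aBits rfl)
  refine (runs_flipProg (by omega) hs1.vars hv.le hV1 hr1).seq fun s2 hf2 hr2 => ?_
  have hs2 := hs1.frame hf2 rfl
  refine (runs_evalTotal _ hs2.apps (by omega) fun w hw => hr2.getD_val hw.le).seq
    fun s3 hf3 hnew => ?_
  have hr3 := hr2.congr (hf3.natArr aLabels rfl) (hf3.natArr aBits rfl)
  have hcmp : (Test.realLe (.reg 1) (.reg 0)).Holds s3 ↔
      total L σ ≤ total L (lab.flip (fun c => c == lab v) σ) := by
    simp [Test.Holds, hnew, hf3.real 1 rfl, hf2.real 1 rfl, hold]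
  refine runs_ite (fun h => runs_skip ⟨_, hr3, fun hne => ?_⟩) fun h => ?_
  · obtain ⟨hsound, h0, hbest⟩ := hσ hne
    rw [hcmp] at h
    exact ⟨hsound.flip _, ((pos_iff_ne_zero.2 h0).trans_le h).ne', hbest.flip hf h0 h⟩
  · have hvars := (hf3.nat rVars rfl).trans hs2.vars
    have hvar : s3.natReg rVar = v := by
      rw [hf3.nat rVar rfl, hf2.nat rVar rfl, hV1]
    refine (runs_flipProg (by omega) hvars hv.le hvar hr3).imp
      fun s4 _ hr4 => ⟨σ, ?_, fun hne => ?_⟩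
    · convert hr4 using 1
      funext w
      simp [Labelling.flip]
    · obtain ⟨hsound, h0, hbest⟩ := hσ hne
      rw [hcmp, not_le] at h
      exact ⟨hsound, h0, hbest.keep hf h0 h.le⟩

theorem runs_improveProg (hf : lab.FlipsIndependent (total L)) (hs : s.HasInput L)
    (hB : n + 1 + (L.flatMap nats).length ≤ B) (hr : Represents n s lab σ)
    (hσ : lab.Sound (support L) σ) (h0 : (support L).Nonempty → total L σ ≠ 0) :
    Runs B improveProg s fun s' => ∃ σ', Represents n s' lab σ' ∧
      ∀ τ ∈ support L, total L τ ≤ total L σ' := by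
  refine Runs.imp (runs_forN (GreedyInv L lab) rfl (by omega)
    (fun s' hf' => (hf'.nat rVars rfl).trans hs.vars)
    (fun i s' v ⟨σ', hr', h⟩ => ⟨σ', hr'.congr rfl rfl, h⟩)
    ⟨σ, hr, fun hne => ⟨hσ, h0 hne, Labelling.bestBelow_zero _ _ _⟩⟩
    fun v hv s' hf' hV hI => runs_improveStep hf (hs.frame hf' rfl) hB hv hV hI)
    fun s' _ ⟨σ', hr', h⟩ => ⟨σ', hr', fun τ hτ => ?_⟩
  obtain ⟨hsound, -, hbest⟩ := h ⟨τ, hτ⟩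
  exact hbest.le_of_mem (dependsOn_total L) hsound hτ

/-- Start with a class of its own and the value `0` for every variable. -/
def initProg : Prog :=
  forN rCount (.reg rVars + .const 1)
    (.instr (.pushNat aLabels (.reg rCount)) ;; .instr (.pushNat aBits (.const 0)))

theorem runs_initProg (hB : n + 1 ≤ B) (hn : s.natReg rVars = n) (hlab : s.natArr aLabels = [])
    (hval : s.natArr aBits = []) :
    Runs B initProg s fun s' => Represents n s' id fun _ => false := by
  refine Runs.imp (runs_forN (fun i s' => s'.natArr aLabels = List.range i ∧
      s'.natArr aBits = (List.range i).map fun _ => 0) rfl hB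
    (fun s' hf => by simp [hf.nat rVars rfl, hn]) (by simp) (by simp [hlab, hval])
    fun i _ s' _ h16 ⟨h1, h2⟩ => runs_instr_seq (runs_instr.2 ?_))
    fun s' _ h => ⟨by rw [h.1, List.map_id], h.2⟩
  simp [h16, h1, h2, List.range_succ]

theorem sound_id (A : Set (ℕ → Bool)) (σ : ℕ → Bool) : Labelling.Sound A id σ := by
  rintro τ - u v (rfl : u = v)
  rfl

/-- Give the additional variable the value `false`. -/
def resetProg : Prog :=
  setN rVar (.reg rVars) ;; .ite (.eq (.get aBits (.reg rVars)) (.const 1)) flipProg skip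

theorem runs_resetProg (hB : n + 1 ≤ B) (hn : s.natReg rVars = n) (hr : Represents n s lab σ)
    (hσ : lab.Sound (support L) σ) :
    Runs B resetProg s fun s' =>
      ∃ σ', Represents n s' lab σ' ∧ lab.Sound (support L) σ' ∧ σ' n = false := by
  have hval := hr.getD_val le_rfl
  refine runs_instr_seq (runs_ite (fun h => (runs_flipProg (v := n) (σ := σ) (lab := lab) hB
    (by simp [hn]) le_rfl (by simp [hn]) (hr.congr (by simp) (by simp))).imp
      fun s' _ hr' => ⟨_, hr', hσ.flip _, ?_⟩)
    fun h => runs_skip ⟨σ, hr.congr (by simp) (by simp), hσ, ?_⟩)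
  · have : σ n = true := by simpa [hn, hval] using h
    simp [Labelling.flip, this]
  · simpa [hn, hval] using h

/-- Output the values of the variables. -/
def outputProg : Prog :=
  .instr (.clearReal 0) ;; .instr (.clearNat 0) ;;
  forN rCount (.reg rVars) (.instr (.pushNat 0 (.get aBits (.reg rCount))))

theorem runs_outputProg (hB : n ≤ B) (hn : s.natReg rVars = n) (hr : Represents n s lab σ) :
    Runs B outputProg s fun s' => s'.output = encAssignment fun v : Fin n => σ v := by
  refine runs_instr_seq (runs_instr_seq (Runs.imp (runs_forN
    (fun i s' => s'.natArr 0 = (List.range i).map fun w => (σ w).toNat) rfl hB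
    (fun s' hf => by simp [hf.nat rVars rfl, hn]) (by simp) (by simp)
    fun i hi s' hf h16 h => runs_instr.2 ?_) fun s' hf h => ?_))
  · have hval := hr.getD_val hi.le
    simp [h16, h, List.range_succ, hf.natArr aBits rfl, hval]
  · simp only [State.output, h, hf.realArr 0 rfl, encAssignment, Word.mk.injEq]
    exact ⟨List.ext_getElem (by simp) fun i _ _ => by simp, by simp⟩

/-- Compute an optimal assignment. -/
def optimumProg : Prog :=
  setN rVars (.get 0 (.const 0)) ;; setN rStart (.const 1) ;; setN rEnd (.natLen 0) ;;
  initProg ;; tiesProg ;; resetProg ;; improveProg ;; outputProg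

theorem runs_optimumProg {F : Set Constraint} (hF : F ⊆ Constraint.ED) (x : CSPInstance F)
    (hB : x.enc.size ≤ B) : Runs B optimumProg (State.init x.enc) fun s =>
      ∃ σ : Fin x.n → Bool, s.output = encAssignment σ ∧ ∀ τ : Fin x.n → Bool,
        (x.apps.map fun a => a.value τ).prod ≤ (x.apps.map fun a => a.value σ).prod := by
  have hL : ∀ a ∈ x.apps, a.con ∈ Constraint.ED := fun a ha => hF (x.mem a ha)
  rw [x.size_enc] at hB
  set s0 := (Instr.setNat rEnd (.natLen 0)).exec ((Instr.setNat rStart (.const 1)).exec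
    ((Instr.setNat rVars (.get 0 (.const 0))).exec (State.init x.enc))) with hs0
  have hin : s0.HasInput x.apps :=
    ⟨rfl, by simpa [hs0, State.init] using x.encodes_enc⟩
  refine runs_instr_seq (runs_instr_seq (runs_instr_seq ?_))
  refine (runs_initProg (by omega) hin.vars rfl rfl).seq fun s1 hf1 hr1 => ?_
  have hin1 := hin.frame hf1 rfl
  refine (runs_tiesProg hin1 (by omega) ⟨_, _, hr1, sound_id _ _, by simp⟩).seq
    fun s2 hf2 ⟨lab, σ₂, hr2, hS2, hC⟩ => ?_
  have hin2 := hin1.frame hf2 rfl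
  refine (runs_resetProg (by omega) hin2.vars hr2 hS2).seq fun s3 hf3 ⟨σ₃, hr3, hS3, hn⟩ => ?_
  have hin3 := hin2.frame hf3 rfl
  refine (runs_improveProg (hC.flipsIndependent hL) hin3 (by omega) hr3 hS3
    fun ⟨τ, hτ⟩ => hC.total_ne_zero hL hS3 hn hτ).seq fun s4 hf4 ⟨σ, hr4, hmax⟩ => ?_
  refine (runs_outputProg (by omega) (hin3.frame hf4 rfl).vars hr4).imp
    fun s5 _ hout => ⟨fun v => σ v, hout, fun τ => ?_⟩
  rw [← total_padTuple τ]
  by_cases h0 : total x.apps (padTuple τ) = 0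
  · simp [h0]
  · exact hmax _ ⟨h0, padTuple_self τ⟩

end RealRAM

section Problem

theorem maxProdCSP_optimumComputable {F : Set Constraint} (hF : F ⊆ Constraint.ED) :
    (maxProdCSP F).OptimumComputable := by
  obtain ⟨p, hp⟩ := RealRAM.optimumProg.exists_cost_poly
  refine ⟨RealRAM.optimumProg, p, fun x => ?_⟩
  obtain ⟨s, t, h1, h2, σ, h3, h4⟩ := RealRAM.runs_optimumProg hF x le_rfl
  exact ⟨σ, h4, s, t, h1, h2.trans (hp _).ge, h3⟩

end Problem

/-! ## Programs as subroutines -/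

namespace RealRAM

variable {B : ℕ} {s : State}

/-- Add `K` to all numbers of registers and arrays. -/
def NatExp.shift (K : ℕ) : NatExp → NatExp
  | .const c => .const c
  | .reg r => .reg (K + r)
  | .natLen a => .natLen (K + a)
  | .realLen a => .realLen (K + a)
  | .get a i => .get (K + a) (i.shift K)
  | .add e₁ e₂ => .add (e₁.shift K) (e₂.shift K)
  | .sub e₁ e₂ => .sub (e₁.shift K) (e₂.shift K)

/-- Add `K` to all numbers of registers and arrays. -/
def RealExp.shift (K : ℕ) : RealExp → RealExp
  | .const c => .const c
  | .reg r => .reg (K + r)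
  | .get a i => .get (K + a) (i.shift K)
  | .add e₁ e₂ => .add (e₁.shift K) (e₂.shift K)
  | .sub e₁ e₂ => .sub (e₁.shift K) (e₂.shift K)
  | .mul e₁ e₂ => .mul (e₁.shift K) (e₂.shift K)
  | .div e₁ e₂ => .div (e₁.shift K) (e₂.shift K)

/-- Add `K` to all numbers of registers and arrays. -/
def Test.shift (K : ℕ) : Test → Test
  | .natLe e₁ e₂ => .natLe (e₁.shift K) (e₂.shift K)
  | .realLe e₁ e₂ => .realLe (e₁.shift K) (e₂.shift K)
  | .not b => .not (b.shift K)
  | .and b₁ b₂ => .and (b₁.shift K) (b₂.shift K)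

/-- Add `K` to all numbers of registers and arrays. -/
def Instr.shift (K : ℕ) : Instr → Instr
  | .setNat r e => .setNat (K + r) (e.shift K)
  | .setReal r e => .setReal (K + r) (e.shift K)
  | .clearNat a => .clearNat (K + a)
  | .clearReal a => .clearReal (K + a)
  | .pushNat a e => .pushNat (K + a) (e.shift K)
  | .pushReal a e => .pushReal (K + a) (e.shift K)
  | .popNat a => .popNat (K + a)
  | .popReal a => .popReal (K + a)
  | .writeNat a i e => .writeNat (K + a) (i.shift K) (e.shift K)
  | .writeReal a i e => .writeReal (K + a) (i.shift K) (e.shift K)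

/-- Add `K` to all numbers of registers and arrays, so that the program cannot interfere with
another one that only uses smaller numbers. -/
def Prog.shift (K : ℕ) : Prog → Prog
  | .instr a => .instr (a.shift K)
  | .seq c d => .seq (c.shift K) (d.shift K)
  | .ite b c d => .ite (b.shift K) (c.shift K) (d.shift K)
  | .loop b c => .loop (b.shift K) (c.shift K)

/-- The part of the memory that a shifted program can access. -/
def State.view (K : ℕ) (s : State) : State where
  natReg r := s.natReg (K + r)
  realReg r := s.realReg (K + r)
  natArr r := s.natArr (K + r)
  realArr r := s.realArr (K + r)

theorem NatExp.eval_shift (K : ℕ) (s : State) (e : NatExp) :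
    (e.shift K).eval s = e.eval (s.view K) := by
  induction e <;> simp_all [NatExp.shift, State.view]

theorem RealExp.eval_shift (K : ℕ) (s : State) (e : RealExp) :
    (e.shift K).eval s = e.eval (s.view K) := by
  induction e <;> simp_all [RealExp.shift, NatExp.eval_shift] <;> rfl

theorem Test.holds_shift (K : ℕ) (s : State) (b : Test) :
    (b.shift K).Holds s ↔ b.Holds (s.view K) := by
  induction b <;>
    simp_all [Test.shift, Test.Holds, NatExp.eval_shift, RealExp.eval_shift]

theorem update_add_left {α : Type*} (f : ℕ → α) (K r : ℕ) (a : α) :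
    (fun x => Function.update f (K + r) a (K + x)) = Function.update (fun x => f (K + x)) r a := by
  funext x
  simp [Function.update_apply]

theorem Instr.view_exec_shift (K : ℕ) (s : State) (a : Instr) :
    ((a.shift K).exec s).view K = a.exec (s.view K) := by
  cases a <;>
    simp only [Instr.shift, Instr.exec, State.view, update_add_left, NatExp.eval_shift,
      RealExp.eval_shift]

theorem Exec.shift {c : Prog} {s₀ s' : State} {t : ℕ} (h : Exec c s₀ s' t) (K : ℕ) :
    ∀ s : State, s.view K = s₀ → ∃ s'', Exec (c.shift K) s s'' t ∧ s''.view K = s' := by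
  induction h with
  | instr a _ =>
    rintro s rfl
    exact ⟨_, .instr _ s, a.view_exec_shift K s⟩
  | seq _ _ h1 h2 =>
    intro s hs
    obtain ⟨s1, e1, v1⟩ := h1 s hs
    obtain ⟨s2, e2, v2⟩ := h2 s1 v1
    exact ⟨s2, .seq e1 e2, v2⟩
  | iteTrue hb _ h1 =>
    rintro s rfl
    obtain ⟨s1, e1, v1⟩ := h1 s rfl
    exact ⟨s1, .iteTrue ((Test.holds_shift K s _).2 hb) e1, v1⟩
  | iteFalse hb _ h1 =>
    rintro s rfl
    obtain ⟨s1, e1, v1⟩ := h1 s rfl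
    exact ⟨s1, .iteFalse ((Test.holds_shift K s _).not.2 hb) e1, v1⟩
  | loopTrue hb _ _ h1 h2 =>
    rintro s rfl
    obtain ⟨s1, e1, v1⟩ := h1 s rfl
    obtain ⟨s2, e2, v2⟩ := h2 s1 v1
    exact ⟨s2, .loopTrue ((Test.holds_shift K s _).2 hb) e1 e2, v2⟩
  | loopFalse hb =>
    rintro s rfl
    exact ⟨s, .loopFalse ((Test.holds_shift K s _).not.2 hb), rfl⟩

/-- The number of the register or array that an instruction changes. -/
def Instr.target : Instr → ℕ
  | .setNat r _ => r
  | .setReal r _ => r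
  | .clearNat a => a
  | .clearReal a => a
  | .pushNat a _ => a
  | .pushReal a _ => a
  | .popNat a => a
  | .popReal a => a
  | .writeNat a _ _ => a
  | .writeReal a _ _ => a

/-- A bound for the numbers of the registers and arrays that a program changes. -/
def Prog.bound : Prog → ℕ
  | .instr a => a.target + 1
  | .seq c d => max c.bound d.bound
  | .ite _ c d => max c.bound d.bound
  | .loop _ c => c.bound

/-- The program may change a register or array with number `r`. -/
abbrev Prog.targets (c : Prog) (r : ℕ) : Bool := c.any fun a => a.target == r

theorem Prog.any_eq_false_of_imp {c : Prog} {f g : Instr → Bool} (h : c.any g = false)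
    (hfg : ∀ a, g a = false → f a = false) : c.any f = false := by
  induction c with
  | instr a => exact hfg a h
  | seq _ _ h1 h2 | ite _ _ _ h1 h2 =>
    simp only [Prog.any, Bool.or_eq_false_iff] at h ⊢
    exact ⟨h1 h.1, h2 h.2⟩
  | loop _ _ h1 => exact h1 h

theorem Frame.of_targets {c : Prog} {s s' : State} (hf : Frame c s s') {r : ℕ}
    (h : c.targets r = false) : s'.natReg r = s.natReg r ∧ s'.realReg r = s.realReg r ∧
      s'.natArr r = s.natArr r ∧ s'.realArr r = s.realArr r := by
  refine ⟨hf.nat r ?_, hf.real r ?_, hf.natArr r ?_, hf.realArr r ?_⟩ <;>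
  · refine Prog.any_eq_false_of_imp h fun a ha => ?_
    cases a <;> first | rfl | exact ha

theorem Prog.targets_of_bound_le {c : Prog} {r : ℕ} (hc : c.bound ≤ r) : c.targets r = false := by
  induction c with
  | instr a =>
    simp only [Prog.bound] at hc
    exact beq_false_of_ne (by omega)
  | seq _ _ h1 h2 | ite _ _ _ h1 h2 =>
    simp only [Prog.bound, max_le_iff] at hc
    simp only [Prog.targets, Prog.any, h1 hc.1, h2 hc.2, Bool.or_self]
  | loop _ _ h1 => exact h1 hc

theorem Prog.targets_shift {K r : ℕ} (hr : r < K) (c : Prog) :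
    (c.shift K).targets r = false := by
  induction c with
  | instr a =>
    cases a <;> exact beq_false_of_ne (by simp only [Instr.shift, Instr.target]; omega)
  | seq _ _ h1 h2 | ite _ _ _ h1 h2 =>
    simp only [Prog.targets, Prog.shift, Prog.any, h1, h2, Bool.or_self]
  | loop _ _ h1 => exact h1

theorem Prog.bound_shift (c : Prog) (K : ℕ) : (c.shift K).bound = K + c.bound := by
  induction c with
  | instr a => cases a <;> simp only [Prog.shift, Prog.bound, Instr.shift, Instr.target] <;> omega
  | seq _ _ h1 h2 | ite _ _ _ h1 h2 => simp only [Prog.shift, Prog.bound, h1, h2]; omega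
  | loop _ _ h1 => exact h1

/-- Registers and arrays from number `M` on are in their initial state. -/
structure Clean (M : ℕ) (s : State) : Prop where
  nat : ∀ r, M ≤ r → s.natReg r = 0
  real : ∀ r, M ≤ r → s.realReg r = 0
  natArr : ∀ r, M ≤ r → s.natArr r = []
  realArr : ∀ r, M ≤ r → s.realArr r = []

theorem Clean.frame {M : ℕ} {s s' : State} (h : Clean M s) {c : Prog} (hf : Frame c s s')
    (hc : c.bound ≤ M) : Clean M s' := by
  have hs := fun r (hr : M ≤ r) => hf.of_targets (Prog.targets_of_bound_le (hc.trans hr))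
  exact ⟨fun r hr => (hs r hr).1.trans (h.nat r hr), fun r hr => (hs r hr).2.1.trans (h.real r hr),
    fun r hr => (hs r hr).2.2.1.trans (h.natArr r hr),
    fun r hr => (hs r hr).2.2.2.trans (h.realArr r hr)⟩

theorem clean_init {M : ℕ} (w : Word) (hM : 0 < M) : Clean M (State.init w) := by
  constructor <;> intro r hr <;> simp [State.init, (hM.trans_le hr).ne']

theorem Clean.view_eq_init {K : ℕ} {s s' : State} {c : Prog} {w : Word} (h : Clean K s)
    (hf : Frame c s s') (hc : ∀ r, c.targets (K + (r + 1)) = false) (hK : c.writesNat K = false)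
    (hK' : c.writesReal K = false) (hN : s'.natArr K = w.nats) (hR : s'.realArr K = w.reals) :
    s'.view K = State.init w := by
  have hs := fun r => hf.of_targets (hc r)
  simp only [State.view, State.init, State.mk.injEq]
  refine ⟨?_, ?_, ?_, ?_⟩ <;> funext r <;> cases r with
  | zero => simp [hN, hR, hf.nat K hK, hf.real K hK', h.nat, h.real]
  | succ r => simp [hs, h.nat, h.real, h.natArr, h.realArr]

theorem Prog.Yields.runs_shift {c : Prog} {w v : Word} {T K : ℕ} (h : c.Yields w v T)
    (hT : T ≤ B) (hs : s.view K = State.init w) :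
    Runs B (c.shift K) s fun s' => s'.natArr K = v.nats ∧ s'.realArr K = v.reals := by
  obtain ⟨s₁, t, hexec, ht, rfl⟩ := h
  obtain ⟨s₂, hexec', rfl⟩ := hexec.shift K s hs
  exact ⟨s₂, t, hexec', hexec'.le_cost (ht.trans hT), rfl, rfl⟩

/-- Reset the registers and arrays number `r`. -/
def cleanOne (r : ℕ) : Prog :=
  setN r (.const 0) ;; setR r (.const 0) ;; .instr (.clearNat r) ;; .instr (.clearReal r)

/-- Reset the registers and arrays from number `K` to number `K + N`. -/
def cleanProg (K : ℕ) : ℕ → Prog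
  | 0 => cleanOne K
  | N + 1 => cleanOne (K + N + 1) ;; cleanProg K N

theorem runs_cleanOne {r : ℕ} (h : Clean (r + 1) s) : Runs B (cleanOne r) s (Clean r) := by
  refine runs_instr_seq (runs_instr_seq (runs_instr_seq (runs_instr.2 ?_)))
  constructor <;> intro x hx <;> rcases Nat.eq_or_lt_of_le hx with rfl | hx'
  · simp
  · simp [hx'.ne', h.nat x hx']
  · simp
  · simp [hx'.ne', h.real x hx']
  · simp
  · simp [hx'.ne', h.natArr x hx']
  · simp
  · simp [hx'.ne', h.realArr x hx']

theorem runs_cleanProg {K N : ℕ} (h : Clean (K + N + 1) s) :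
    Runs B (cleanProg K N) s (Clean K) := by
  induction N generalizing s with
  | zero => exact runs_cleanOne h
  | succ N ih => exact (runs_cleanOne h).seq fun s' _ h' => ih h'

theorem targets_cleanProg {K r : ℕ} (hr : r < K) (N : ℕ) :
    (cleanProg K N).targets r = false := by
  have hone : ∀ x, r < x → (cleanOne x).targets r = false := fun x hx => by
    simp [cleanOne, Prog.any, Instr.target, hx.ne']
  induction N with
  | zero => exact hone _ hr
  | succ N ih =>
    simp only [Prog.targets, cleanProg, Prog.any, ih, hone (K + N + 1) (by omega), Bool.or_self]

theorem bound_cleanProg (K N : ℕ) : (cleanProg K N).bound = K + N + 1 := by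
  induction N with
  | zero => simp [cleanProg, cleanOne, Prog.bound, Instr.target]
  | succ N ih =>
    simp only [cleanProg, cleanOne, Prog.bound, Instr.target, ih, max_self]
    omega

end RealRAM

/-! ## Recognition of instances -/

theorem isPrefix_drop_iff {α : Type*} {l L : List α} (hl : l ≠ []) (p : ℕ) (d : α) :
    l <+: L.drop p ↔
      p + l.length ≤ L.length ∧ ∀ i (h : i < l.length), L.getD (p + i) d = l[i] := by
  have hpos := List.length_pos_iff.2 hl
  rw [List.prefix_iff_getElem]
  simp only [List.length_drop, List.getElem_drop]
  constructor
  · rintro ⟨hle, h⟩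
    refine ⟨by omega, fun i hi => ?_⟩
    rw [List.getD_eq_getElem _ _ (by omega), h i hi]
  · rintro ⟨hle, h⟩
    refine ⟨by omega, fun i hi => ?_⟩
    rw [← h i hi, List.getD_eq_getElem _ _ (by omega)]

namespace Application

variable {n : ℕ} {L : List (Application n)} {a b : Application n} {N : List ℕ} {R : List ℝ}
  {F : Set Constraint}

theorem isPrefix_drop_iff_storedAt {p q : ℕ} :
    a.nats <+: N.drop p ∧ a.con.table <+: R.drop q ↔ (p + a.con.arity + 1 ≤ N.length ∧
      q + 2 ^ a.con.arity ≤ R.length) ∧ a.StoredAt N R p q := by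
  rw [isPrefix_drop_iff (by simp [nats]) p 0,
    isPrefix_drop_iff (List.length_pos_iff.1 (by simp [Constraint.table_length])) q 0]
  simp only [length_nats, Constraint.table_length, ← add_assoc]
  rw [and_and_and_comm]
  refine and_congr_right fun _ =>
    ⟨fun ⟨hN, hR⟩ => ⟨hN 0 (by omega), fun i hi => ?_, fun m hm => ?_⟩,
      fun h => ⟨fun i hi => ?_, fun m hm => ?_⟩⟩
  · rw [add_assoc, add_comm 1 i, hN (i + 1) (by omega)]
    simp [nats]
  · rw [hR m hm]
    simp [Constraint.table]
  · cases i with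
    | zero => exact h.arity
    | succ i =>
      rw [← add_assoc, add_right_comm, h.vars i (by omega)]
      simp [nats]
  · rw [h.table m hm]
    simp [Constraint.table]

/-- The encoding of the constraint with the arity at position `p` and the table at position `q`. -/
def conWord (N : List ℕ) (R : List ℝ) (p q : ℕ) : Word :=
  ⟨[N.getD p 0], (List.range (2 ^ N.getD p 0)).map fun m => R.getD (q + m) 0⟩

theorem StoredAt.conWord_eq {p q : ℕ} (h : a.StoredAt N R p q) : conWord N R p q = a.con.enc := by
  simp only [conWord, Constraint.enc, h.arity, Word.mk.injEq, true_and]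
  refine List.ext_getElem (by simp [Constraint.table_length]) fun m hm _ => ?_
  have := h.table m (by simpa using hm)
  simpa [Constraint.table] using this

theorem exists_storedAt_iff {p q : ℕ} : (∃ a : Application n, a.con ∈ F ∧ a.StoredAt N R p q) ↔
    (∀ i < N.getD p 0, N.getD (p + 1 + i) 0 < n) ∧ conWord N R p q ∈ Constraint.enc '' F := by
  constructor
  · rintro ⟨a, ha, hs⟩
    refine ⟨fun i hi => ?_, a.con, ha, hs.conWord_eq.symm⟩
    rw [hs.arity] at hi
    exact (hs.vars i hi).trans_lt (Fin.is_lt _)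
  · rintro ⟨hn, f, hf, hfw⟩
    simp only [Constraint.enc, conWord, Word.mk.injEq, List.cons.injEq, and_true] at hfw
    obtain ⟨hk, ht⟩ := hfw
    refine ⟨⟨f, fun i => ⟨_, hn i (hk ▸ i.2)⟩⟩, hf, hk.symm, fun _ _ => rfl, fun m hm => ?_⟩
    have := List.getElem_of_eq ht (i := m) (by rwa [Constraint.table_length])
    simpa [Constraint.table] using this.symm

/-- The data of two applications of arity `k`, at the positions `p`, `q` and `p'`, `q'`, agree. -/
def SameData (N : List ℕ) (R : List ℝ) (k p q p' q' : ℕ) : Prop :=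
  (∀ i < k + 1, N.getD (p + i) 0 = N.getD (p' + i) 0) ∧
    ∀ m < 2 ^ k, R.getD (q + m) 0 = R.getD (q' + m) 0

theorem sameData_iff {p q p' q' : ℕ} (hb : b.StoredAt N R p q) (ha : a.StoredAt N R p' q') :
    SameData N R a.con.arity p q p' q' ↔ b = a := by
  constructor
  · rintro ⟨hN, hR⟩
    obtain ⟨⟨k, f⟩, v⟩ := a
    obtain ⟨⟨k', f'⟩, v'⟩ := b
    obtain rfl : k' = k := hb.arity.symm.trans ((hN 0 (by omega)).trans ha.arity)
    obtain rfl : f' = f := by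
      funext z
      obtain ⟨m, rfl⟩ := Constraint.lexTuple_surjective k' z
      exact NNReal.coe_injective
        ((hb.table m m.2).symm.trans ((hR m m.2).trans (ha.table m m.2)))
    obtain rfl : v' = v := by
      funext i
      have := hN (1 + i) (by have := i.2; simp only at this ⊢; omega)
      rw [← add_assoc, ← add_assoc, hb.vars i i.2, ha.vars i i.2] at this
      exact Fin.ext this
    rfl
  · rintro rfl
    refine ⟨fun i hi => ?_, fun m hm => (hb.table m hm).trans (ha.table m hm).symm⟩
    cases i with
    | zero => exact hb.arity.trans ha.arity.symm
    | succ i =>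
      rw [add_comm i 1, ← add_assoc, ← add_assoc, hb.vars i (by omega), ha.vars i (by omega)]

theorem Encodes.notMem_iff {start limit p q : ℕ} (hE : Encodes L N R start limit)
    (ha : a.StoredAt N R p q) : a ∉ L ↔ ∀ i < L.length,
      ¬ SameData N R (N.getD p 0) (natPos start L i) (realPos L i) p q := by
  rw [List.mem_iff_getElem, ha.arity]
  push Not
  exact forall₂_congr fun i hi => (sameData_iff (hE.stored i hi) ha).not.symm

/-- The data at the positions `p` and `q` describe an application that can follow those in `L`. -/
def ReadOk (F : Set Constraint) (L : List (Application n)) (N : List ℕ) (R : List ℝ)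
    (p q : ℕ) : Prop :=
  ∃ a : Application n, (a ∉ L ∧ a.con ∈ F) ∧ a.nats <+: N.drop p ∧ a.con.table <+: R.drop q

theorem readOk_iff {start limit p q : ℕ} (hE : Encodes L N R start limit) :
    ReadOk F L N R p q ↔ (p + N.getD p 0 + 1 ≤ N.length ∧ q + 2 ^ N.getD p 0 ≤ R.length) ∧
      ((∀ i < N.getD p 0, N.getD (p + 1 + i) 0 < n) ∧ conWord N R p q ∈ Constraint.enc '' F) ∧
      ∀ i < L.length, ¬ SameData N R (N.getD p 0) (natPos start L i) (realPos L i) p q := by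
  simp only [ReadOk, isPrefix_drop_iff_storedAt, ← exists_storedAt_iff]
  constructor
  · rintro ⟨a, ⟨hL, hF⟩, hfit, hs⟩
    exact ⟨hs.arity ▸ hfit, ⟨a, hF, hs⟩, (hE.notMem_iff hs).1 hL⟩
  · rintro ⟨hfit, ⟨a, hF, hs⟩, hL⟩
    exact ⟨a, ⟨(hE.notMem_iff hs).2 hL, hF⟩, hs.arity ▸ hfit, hs⟩

theorem isPrefix_of_flatMap_isPrefix : ∀ L L' : List (Application n),
    L.flatMap nats <+: L'.flatMap nats →
    (L.flatMap fun a => a.con.table) <+: (L'.flatMap fun a => a.con.table) → L <+: L'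
  | [], _, _, _ => List.nil_prefix
  | _ :: _, [], h, _ => by simp [nats] at h
  | a :: L, b :: L', ⟨N, hN⟩, ⟨R, hR⟩ => by
    simp only [List.flatMap_cons, List.append_assoc] at hN hR
    have harity : a.con.arity = b.con.arity := by
      simp only [nats, List.cons_append, List.cons.injEq] at hN
      exact hN.1
    obtain ⟨hab, hN'⟩ := List.append_inj hN (by simp only [length_nats, harity])
    obtain ⟨hab', hR'⟩ := List.append_inj hR (by simp only [Constraint.table_length, harity])
    obtain rfl : a = b := by
      simpa using flatMap_inj [a] [b] (by simpa using hab) (by simpa using hab')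
    exact (List.cons_prefix_cons).2
      ⟨rfl, isPrefix_of_flatMap_isPrefix L L' ⟨N, hN'⟩ ⟨R, hR'⟩⟩

end Application

namespace CSPInstance

open Application

variable {F : Set Constraint} {x y : CSPInstance F} {w : Word}

/-- The word `w` starts with the data of the instance `x`. -/
structure Starts (x : CSPInstance F) (w : Word) : Prop where
  nats : x.enc.nats <+: w.nats
  reals : x.enc.reals <+: w.reals

/-- The instance `x` with one more application. -/
def snoc (x : CSPInstance F) (a : Application x.n) (ha : a ∉ x.apps ∧ a.con ∈ F) :
    CSPInstance F where
  n := x.n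
  apps := x.apps ++ [a]
  nodup := List.concat_eq_append ▸ x.nodup.concat ha.1
  mem b hb := by
    rcases List.mem_append.1 hb with hb | hb
    · exact x.mem b hb
    · exact List.mem_singleton.1 hb ▸ ha.2

theorem enc_snoc (a : Application x.n) (ha : a ∉ x.apps ∧ a.con ∈ F) :
    (x.snoc a ha).enc = ⟨x.enc.nats ++ a.nats, x.enc.reals ++ a.con.table⟩ := by
  simp [enc, snoc]

theorem Starts.snoc (h : x.Starts w) {a : Application x.n} (ha : a ∉ x.apps ∧ a.con ∈ F)
    (hN : a.nats <+: w.nats.drop x.enc.nats.length)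
    (hR : a.con.table <+: w.reals.drop x.enc.reals.length) : (x.snoc a ha).Starts w := by
  obtain ⟨N, hN'⟩ := h.nats
  obtain ⟨R, hR'⟩ := h.reals
  rw [← hN', List.drop_left] at hN
  rw [← hR', List.drop_left] at hR
  refine ⟨?_, ?_⟩ <;> rw [enc_snoc]
  · rw [← hN']
    exact (List.prefix_append_right_inj _).2 hN
  · rw [← hR']
    exact (List.prefix_append_right_inj _).2 hR

theorem Starts.encodes (h : x.Starts w) : Encodes x.apps w.nats w.reals 1 x.enc.nats.length := by
  obtain ⟨⟨N, hN⟩, ⟨R, hR⟩⟩ := h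
  have := encodes_append x.apps [x.n] N R
  rw [← hN, ← hR]
  convert this using 1
  · simp [enc]
  · rfl
  · rfl
  · simp [enc, add_comm]

theorem Starts.exists_apps_append (h : x.Starts y.enc) :
    ∃ (L : List (Application x.n)) (hL : (x.apps ++ L).Nodup) (hF : ∀ a ∈ x.apps ++ L, a.con ∈ F),
      y = ⟨x.n, x.apps ++ L, hL, hF⟩ := by
  obtain ⟨n, L, hL, hF⟩ := x
  obtain ⟨m, L', hL', hF'⟩ := y
  obtain ⟨rfl, hN⟩ := List.cons_prefix_cons.1 h.nats
  obtain ⟨L₂, rfl⟩ := isPrefix_of_flatMap_isPrefix L L' hN h.reals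
  exact ⟨L₂, hL', hF', rfl⟩

theorem Starts.readOk (h : x.Starts y.enc) (hlt : x.enc.nats.length < y.enc.nats.length) :
    ReadOk F x.apps y.enc.nats y.enc.reals x.enc.nats.length x.enc.reals.length := by
  obtain ⟨_ | ⟨a, L⟩, hL, hF, rfl⟩ := h.exists_apps_append
  · simp [enc] at hlt
  · refine ⟨a, ⟨fun ha => ?_, hF a (by simp)⟩, ?_, ?_⟩
    · exact List.disjoint_of_nodup_append hL ha (by simp)
    · simp [enc]
    · simp [enc]

theorem Starts.mem_range_enc_iff (h : x.Starts w) (hN : w.nats.length ≤ x.enc.nats.length) :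
    w ∈ Set.range (enc (F := F)) ↔ w.reals.length = x.enc.reals.length := by
  constructor
  · rintro ⟨y, rfl⟩
    obtain ⟨_ | ⟨a, L⟩, hL, hF, rfl⟩ := h.exists_apps_append
    · simp [enc]
    · simp [enc, length_nats] at hN
  · intro hR
    refine ⟨x, ?_⟩
    have hnats := h.nats.eq_of_length_le hN
    have hreals := h.reals.eq_of_length hR.symm
    cases w
    simp only at hnats hreals
    rw [← hnats, ← hreals]

end CSPInstance

namespace RealRAM

open Application

variable {B n p q : ℕ} {s s' : State} {w : Word} {c : Prog} {D : Set Word} {T : Word → ℕ}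
  {L : List (Application n)} {F : Set Constraint}

/-- The input is `w`, the instance has `n` variables, and the applications that have been read end
at the positions `p` and `q`. -/
structure State.Reading (s : State) (w : Word) (n p q : ℕ) : Prop where
  nats : s.natArr 0 = w.nats
  reals : s.realArr 0 = w.reals
  vars : s.natReg rVars = n
  start : s.natReg rStart = 1
  pos : s.natReg rEnd = p
  tab : s.natReg rNewTab = q

theorem State.Reading.frame (h : s.Reading w n p q) (hf : Frame c s s')
    (hc : (c.targets rVars || c.targets rStart || c.targets rEnd || c.targets rNewTab) = false) :
    s'.Reading w n p q := by
  simp only [Bool.or_eq_false_iff] at hc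
  obtain ⟨⟨⟨h0, h20⟩, h21⟩, h22⟩ := hc
  have hf0 := hf.of_targets h0
  exact ⟨hf0.2.2.1.trans h.nats, hf0.2.2.2.trans h.reals, hf0.1.trans h.vars,
    (hf.of_targets h20).1.trans h.start, (hf.of_targets h21).1.trans h.pos,
    (hf.of_targets h22).1.trans h.tab⟩

/-- The arity of the application that follows those that have been read. -/
abbrev newArity : NatExp := .get 0 (.reg rEnd)

theorem State.Reading.eval_newArity (h : s.Reading w n p q) :
    newArity.eval s = w.nats.getD p 0 := by
  simp [h.nats, h.pos]

/-- The program decides membership in `D` within the time `T`. -/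
def Prog.Decides (c : Prog) (D : Set Word) (T : Word → ℕ) : Prop :=
  ∀ w, (w ∈ D → c.Yields w Word.yes (T w)) ∧ (w ∉ D → c.Yields w Word.no (T w))

/-- Make the constraint of the next application the input of a subroutine. -/
def loadInput : Prog :=
  .instr (.pushNat 30 newArity) ;; forN rCount (.reg rNewSize)
    (.instr (.pushReal 30 (.get 0 (.reg rNewTab + .reg rCount))))

theorem runs_loadInput (hR : s.Reading w n p q)
    (hsize : s.natReg rNewSize = 2 ^ w.nats.getD p 0) (hB : 2 ^ w.nats.getD p 0 ≤ B)
    (hN : s.natArr 30 = []) (hR' : s.realArr 30 = []) :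
    Runs B loadInput s fun s' => s'.natArr 30 = (conWord w.nats w.reals p q).nats ∧
      s'.realArr 30 = (conWord w.nats w.reals p q).reals := by
  refine runs_instr_seq ((runs_forN (fun i s' => s'.realArr 30 =
      (List.range i).map fun m => w.reals.getD (q + m) 0) rfl hB (fun s' hf => ?_) (by simp)
    (by simpa using hR') fun i _ s' hf hi h => runs_instr.2 ?_).imp fun s' hf h => ⟨?_, h⟩)
  · simp [hf.nat rNewSize rfl, hsize]
  · simp [h, hf.realArr 0 rfl, hf.nat rNewTab rfl, hR.reals, hR.tab, hi, List.range_succ]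
  · simp [hf.natArr 30 rfl, hN, hR.nats, hR.pos, conWord]

/-- Run the program `c` on the constraint of the next application, and clear the flag if the answer
is negative. -/
def recognize (c : Prog) : Prog :=
  cleanProg 30 c.bound ;; loadInput ;; c.shift 30 ;;
    .ite (.eq (.get 30 (.const 0)) (.const 1)) skip (setN rFlag (.const 0))

theorem targets_recognize (c : Prog) {r : ℕ} (hr : r < 30) (hplace : r ≠ rPlace)
    (hflag : r ≠ rFlag) (hcount : r ≠ rCount) : (recognize c).targets r = false := by
  have hclean := targets_cleanProg hr c.bound
  have hshift := Prog.targets_shift hr c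
  simp only [Prog.targets] at hclean hshift
  simp only [Prog.targets, recognize, loadInput, forN, skip, Prog.any, hclean, hshift]
  simp [Instr.target, hr.ne', hplace.symm, hflag.symm, hcount.symm]

theorem runs_recognize {P : Prop} (hc : c.Decides D T) (hcl : Clean (30 + c.bound + 1) s)
    (hR : s.Reading w n p q) (hP : s.natReg rFlag = flag P)
    (hsize : s.natReg rNewSize = 2 ^ w.nats.getD p 0) (hB : 2 ^ w.nats.getD p 0 ≤ B)
    (hT : T (conWord w.nats w.reals p q) ≤ B) : Runs B (recognize c) s fun s' =>
      s'.natReg rFlag = flag (P ∧ conWord w.nats w.reals p q ∈ D) := by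
  set v := conWord w.nats w.reals p q
  refine (runs_cleanProg hcl).seq fun s1 hf1 hcl1 => ?_
  have hclean : ∀ r < 30, (cleanProg 30 c.bound).targets r = false :=
    fun r hr => targets_cleanProg hr _
  have hR1 := hR.frame hf1 (by simp only [hclean, Nat.reduceLT, Bool.or_self])
  have hsize1 := (hf1.of_targets (hclean rNewSize (by decide))).1.trans hsize
  have hP1 := (hf1.of_targets (hclean rFlag (by decide))).1.trans hP
  refine (runs_loadInput hR1 hsize1 hB (hcl1.natArr 30 le_rfl) (hcl1.realArr 30 le_rfl)).seq
    fun s2 hf2 ⟨hN2, hR2⟩ => ?_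
  have hP2 := (hf2.nat rFlag rfl).trans hP1
  have hinit : s2.view 30 = State.init v := hcl1.view_eq_init hf2 (fun r => by
    simp [loadInput, forN, Prog.any, Instr.target]; omega) rfl rfl hN2 hR2
  have hshift := Prog.targets_shift (K := 30) (r := rFlag) (by decide) c
  by_cases hvD : v ∈ D
  · refine (((hc v).1 hvD).runs_shift hT hinit).seq fun s3 hf3 h3 => runs_ite
      (fun _ => runs_skip ?_) fun h => (h ?_).elim
    · simp only [(hf3.of_targets hshift).1, hP2, hvD, and_true]
    · simp [h3.1, Word.yes, List.getD_cons_zero]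
  · refine (((hc v).2 hvD).runs_shift hT hinit).seq fun s3 _ h3 => runs_ite
      (fun h => ?_) fun _ => runs_instr.2 ?_
    · simp [h3.1, Word.no, List.getD_cons_zero] at h
    · simp [flag_of_not fun h : P ∧ v ∈ D => hvD h.2]

/-- Compare the next application with the application at work. -/
def compareNew : Prog :=
  setN rSame (.const 1) ;;
  checkAll rCount (newArity + .const 1) skip
    (.eq (.get 0 (.reg rPos + .reg rCount)) (.get 0 (.reg rEnd + .reg rCount))) rSame ;;
  checkAll rCount (.reg rNewSize) skip
    (.realEq (.get 0 (.reg rTab + .reg rCount)) (.get 0 (.reg rNewTab + .reg rCount))) rSame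

theorem runs_compareNew {p' q' : ℕ} (hR : s.Reading w n p q) (hpos : s.natReg rPos = p')
    (htab : s.natReg rTab = q') (hsize : s.natReg rNewSize = 2 ^ w.nats.getD p 0)
    (hB : w.nats.getD p 0 + 1 ≤ B) (hB' : 2 ^ w.nats.getD p 0 ≤ B) :
    Runs B compareNew s fun s' =>
      s'.natReg rSame = flag (SameData w.nats w.reals (w.nats.getD p 0) p' q' p q) := by
  refine runs_instr_seq ((runs_checkAll (p := True)
    (q := fun i => w.nats.getD (p' + i) 0 = w.nats.getD (p + i) 0) (by decide) (by decide) rfl rfl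
    hB (by simp [flag_of]) (fun s' hf => ?_) fun i _ s' hf hi => runs_skip ?_).seq
    fun s1 hf1 h1 => (runs_checkAll
      (q := fun m => w.reals.getD (q' + m) 0 = w.reals.getD (q + m) 0) (by decide) (by decide) rfl
      rfl hB' h1 (fun s' hf => ?_) fun i _ s' hf hi => runs_skip ?_).imp fun s2 _ h2 => ?_)
  · simp [hf.natArr 0 rfl, hf.nat rEnd rfl, hR.nats, hR.pos]
  · simp [hf.natArr 0 rfl, hf.nat rEnd rfl, hf.nat rPos rfl, hR.nats, hR.pos, hpos, hi]
  · simp [hf.nat rNewSize rfl, hf1.nat rNewSize rfl, hsize]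
  · simp [hf.realArr 0 rfl, hf.nat rNewTab rfl, hf.nat rTab rfl, hf1.realArr 0 rfl,
      hf1.nat rNewTab rfl, hf1.nat rTab rfl, hR.reals, hR.tab, htab, hi]
  · rw [h2, SameData, true_and]

/-- Clear the flag if the next application has been read before. -/
def checkDistinct : Prog :=
  scan (compareNew ;; .ite (.eq (.reg rSame) (.const 1)) (setN rFlag (.const 0)) skip)

theorem runs_checkDistinct {P : Prop} (hR : s.Reading w n p q)
    (hE : Encodes L w.nats w.reals 1 p) (hP : s.natReg rFlag = flag P)
    (hsize : s.natReg rNewSize = 2 ^ w.nats.getD p 0) (hB : w.nats.getD p 0 + 1 ≤ B)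
    (hB' : 2 ^ w.nats.getD p 0 ≤ B) (hL : (L.flatMap nats).length ≤ B) :
    Runs B checkDistinct s fun s' => s'.natReg rFlag = flag (P ∧ ∀ i < L.length,
      ¬ SameData w.nats w.reals (w.nats.getD p 0) (natPos 1 L i) (realPos L i) p q) := by
  refine runs_scan rfl rfl (by rwa [hR.nats, hR.reals, hR.start, hR.pos]) hL
    (fun i s' => s'.natReg rFlag = flag (P ∧ ∀ j < i,
      ¬ SameData w.nats w.reals (w.nats.getD p 0) (natPos 1 L j) (realPos L j) p q))
    (fun i s s' hf h => (hf.nat rFlag rfl).trans h) (by simpa using hP)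
    fun i hi s' hf _ hpos htab h => ?_
  rw [hR.start] at hpos
  refine (runs_compareNew (hR.frame hf rfl) hpos htab ((hf.nat rNewSize rfl).trans hsize) hB
    hB').seq fun s2 hf2 h2 => ?_
  replace h := (hf2.nat rFlag rfl).trans h
  refine runs_ite (fun hsame => runs_instr.2 ?_) fun hsame => runs_skip ?_
  all_goals
    rw [Test.holds_eq, NatExp.eval, NatExp.eval, h2, flag_eq_one] at hsame
  · rw [flag_of_not fun h' => h'.2 i (Nat.lt_succ_self i) hsame]
    simp
  · simp only [Nat.forall_lt_succ_right, h, hsame, not_false_eq_true, and_true]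

/-- Clear the flag unless the data of the next application make sense, the program `c` accepts its
constraint, and it has not been read before. -/
def checkNew (c : Prog) : Prog :=
  checkAll rCount newArity skip
    (.lt (.get 0 (.reg rEnd + .const 1 + .reg rCount)) (.reg rVars)) rFlag ;;
  recognize c ;; checkDistinct

theorem size_conWord_le (hN : p + w.nats.getD p 0 + 1 ≤ w.nats.length)
    (hR : q + 2 ^ w.nats.getD p 0 ≤ w.reals.length) :
    (conWord w.nats w.reals p q).size ≤ w.size := by
  simp only [conWord, Word.size, List.length_singleton, List.sum_singleton, List.length_map,
    List.length_range]
  omega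

theorem runs_checkNew (hc : c.Decides (Constraint.enc '' F) T) (hcl : Clean (30 + c.bound + 1) s)
    (hR : s.Reading w n p q) (hflag : s.natReg rFlag = 1) (hE : Encodes L w.nats w.reals 1 p)
    (hsize : s.natReg rNewSize = 2 ^ w.nats.getD p 0)
    (hN : p + w.nats.getD p 0 + 1 ≤ w.nats.length)
    (hN' : q + 2 ^ w.nats.getD p 0 ≤ w.reals.length) (hB : w.size + 1 ≤ B)
    (hT : ∀ v : Word, v.size ≤ w.size → T v ≤ B) :
    Runs B (checkNew c) s fun s' => s'.natReg rFlag = flag (ReadOk F L w.nats w.reals p q) ∧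
      s'.Reading w n p q ∧ s'.natReg rNewSize = 2 ^ w.nats.getD p 0 := by
  have hL : (L.flatMap nats).length ≤ p := by
    have := hE.limit_eq
    simp only [natPos, List.take_length] at this
    omega
  simp only [Word.size] at hB
  rw [readOk_iff hE, and_iff_right ⟨hN, hN'⟩]
  refine (runs_checkAll (p := True) (q := fun i => w.nats.getD (p + 1 + i) 0 < n) (by decide)
    (by decide) rfl rfl (by omega) (by simp [hflag, flag_of]) (fun s' hf => (hR.frame hf
      rfl).eval_newArity) fun i _ s' hf hi => runs_skip ?_).seq fun s1 hf1 h1 => ?_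
  · have hR' := hR.frame hf rfl
    simp [hR'.nats, hR'.pos, hR'.vars, hi]
  rw [true_and] at h1
  have hR1 := hR.frame hf1 rfl
  have hsize1 := (hf1.nat rNewSize rfl).trans hsize
  have hcl1 : Clean (30 + c.bound + 1) s1 := hcl.frame hf1
    ((by decide : Prog.bound (checkAll rCount newArity skip _ rFlag) ≤ 30).trans (by omega))
  refine (runs_recognize hc hcl1 hR1 h1 hsize1 (by omega)
    (hT _ (size_conWord_le hN hN'))).seq fun s2 hf2 h2 => ?_
  have htargets : ∀ r, r < 30 → r ≠ rPlace → r ≠ rFlag → r ≠ rCount →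
      (recognize c).targets r = false := fun _ => targets_recognize c
  have hR2 := hR1.frame hf2 (by simp [htargets])
  have hsize2 := (hf2.of_targets (by simp [htargets] :
    (recognize c).targets rNewSize = false)).1.trans hsize1
  exact (runs_checkDistinct hR2 hE h2 hsize2 (by omega) (by omega) (by omega)).imp
    fun _ hf3 h => ⟨h, hR2.frame hf3 rfl, (hf3.nat rNewSize rfl).trans hsize2⟩

/-- Compute the size of the table of the next application. -/
def sizeNew : Prog := setN rPos (.reg rEnd) ;; enterApp ;; setN rNewSize (.reg rSize)

theorem runs_sizeNew (hR : s.Reading w n p q) (hB : w.nats.getD p 0 ≤ B) :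
    Runs B sizeNew s fun s' => s'.natReg rNewSize = 2 ^ w.nats.getD p 0 :=
  runs_instr_seq ((runs_enterApp_of_getD (by simp [hR.nats, hR.pos]) hB).seq
    fun _ _ h => runs_instr.2 (by simp [h.2]))

/-- Move past the next application. -/
def passNew : Prog :=
  setN rNewTab (.reg rNewTab + .reg rNewSize) ;; setN rEnd (.reg rEnd + newArity + .const 1)

theorem runs_passNew (hR : s.Reading w n p q)
    (hsize : s.natReg rNewSize = 2 ^ w.nats.getD p 0) : Runs B passNew s fun s' =>
      s'.Reading w n (p + w.nats.getD p 0 + 1) (q + 2 ^ w.nats.getD p 0) :=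
  runs_instr_seq (runs_instr.2 (by
    constructor <;> simp [hR.nats, hR.reals, hR.vars, hR.start, hR.pos, hR.tab, hsize]))

/-- Read the next application, and clear the flag if it does not exist or is not acceptable. -/
def readNext (c : Prog) : Prog :=
  sizeNew ;; .ite (.and (.natLe (.reg rEnd + newArity + .const 1) (.natLen 0))
      (.natLe (.reg rNewTab + .reg rNewSize) (.realLen 0)))
    (checkNew c ;; passNew) (setN rFlag (.const 0))

theorem runs_readNext (hc : c.Decides (Constraint.enc '' F) T) (hcl : Clean (30 + c.bound + 1) s)
    (hR : s.Reading w n p q) (hflag : s.natReg rFlag = 1) (hE : Encodes L w.nats w.reals 1 p)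
    (hp : p < w.nats.length) (hB : w.size + 1 ≤ B)
    (hT : ∀ v : Word, v.size ≤ w.size → T v ≤ B) :
    Runs B (readNext c) s fun s' =>
      s'.natReg rFlag = flag (ReadOk F L w.nats w.reals p q) ∧ (ReadOk F L w.nats w.reals p q →
        s'.Reading w n (p + w.nats.getD p 0 + 1) (q + 2 ^ w.nats.getD p 0)) := by
  have hk : w.nats.getD p 0 ≤ B := by
    have := List.le_sum_of_mem (List.getElem_mem hp)
    rw [Word.size] at hB
    rw [List.getD_eq_getElem _ _ hp]
    omega
  refine (runs_sizeNew hR hk).seq fun s1 hf1 hsize => ?_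
  have hR1 := hR.frame hf1 rfl
  have hcl1 : Clean (30 + c.bound + 1) s1 := hcl.frame hf1
    ((by decide : sizeNew.bound ≤ 30).trans (by omega))
  refine runs_ite (fun h => ?_) fun h => runs_instr.2 ?_
  all_goals
    simp only [Test.Holds, NatExp.eval, hR1.nats, hR1.reals, hR1.pos, hR1.tab,
      hsize] at h
  · refine (runs_checkNew hc hcl1 hR1 ((hf1.nat rFlag rfl).trans hflag) hE hsize h.1 h.2 hB
      hT).seq fun s2 _ ⟨hflag2, hR2, hsize2⟩ => (runs_passNew hR2 hsize2).imp
        fun s3 hf3 hR3 => ⟨(hf3.nat rFlag rfl).trans hflag2, fun _ => hR3⟩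
  · have : ¬ ReadOk F L w.nats w.reals p q := fun hok => h ((readOk_iff hE).1 hok).1
    simp [this, flag_of_not]

/-- Either the input has been rejected, or it starts with the instance `x` that has been read,
and at most `m` naturals are still to be read. -/
def ReadInv (F : Set Constraint) (w : Word) (m : ℕ) (s : State) : Prop :=
  (s.natReg rFlag = 0 ∧ w ∉ Set.range (CSPInstance.enc (F := F))) ∨
  (s.natReg rFlag = 1 ∧ ∃ x : CSPInstance F, x.Starts w ∧
    s.Reading w x.n x.enc.nats.length x.enc.reals.length ∧ w.nats.length = x.enc.nats.length + m)

theorem readInv_init (hR : s.Reading w (w.nats.getD 0 0) 1 0)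
    (hflag : s.natReg rFlag = flag (1 ≤ w.nats.length)) : ReadInv F w (w.nats.length - 1) s := by
  obtain ⟨_ | ⟨n, N⟩, R⟩ := w
  · rw [flag_of_not (by simp)] at hflag
    refine .inl ⟨hflag, ?_⟩
    rintro ⟨x, hx⟩
    simp [CSPInstance.enc] at hx
  · rw [flag_of (by simp)] at hflag
    refine .inr ⟨hflag, ⟨n, [], List.nodup_nil, by simp⟩, ⟨?_, ?_⟩, ?_, ?_⟩
    · simp [CSPInstance.enc]
    · simp [CSPInstance.enc]
    · simpa [CSPInstance.enc, List.getD_cons_zero] using hR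
    · simp [CSPInstance.enc, add_comm]

theorem runs_readNext_readInv {x : CSPInstance F} {m : ℕ}
    (hc : c.Decides (Constraint.enc '' F) T) (hcl : Clean (30 + c.bound + 1) s)
    (hflag : s.natReg rFlag = 1) (hx : x.Starts w)
    (hR : s.Reading w x.n x.enc.nats.length x.enc.reals.length)
    (hm : w.nats.length = x.enc.nats.length + m) (hm0 : 0 < m) (hB : w.size + 1 ≤ B)
    (hT : ∀ v : Word, v.size ≤ w.size → T v ≤ B) :
    Runs B (readNext c) s fun s' => ∃ m' < m, ReadInv F w m' s' := by
  refine (runs_readNext hc hcl hR hflag hx.encodes (by omega) hB hT).imp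
    fun s' _ ⟨hflag', hR'⟩ => ?_
  by_cases hok : ReadOk F x.apps w.nats w.reals x.enc.nats.length x.enc.reals.length
  · rw [flag_of hok] at hflag'
    replace hR' := hR' hok
    obtain ⟨a, ha, hN, hR⟩ := hok
    have harity := (isPrefix_drop_iff_storedAt.1 ⟨hN, hR⟩).2.arity
    have hlen := hN.length_le
    rw [List.length_drop, length_nats] at hlen
    refine ⟨m - (a.con.arity + 1), by omega, .inr ⟨hflag', x.snoc a ha, hx.snoc ha hN hR, ?_, ?_⟩⟩
    · rw [harity] at hR'
      rw [CSPInstance.enc_snoc]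
      simpa [CSPInstance.snoc, length_nats, Constraint.table_length, add_assoc] using hR'
    · simp only [CSPInstance.enc_snoc, List.length_append, length_nats]
      omega
  · rw [flag_of_not hok] at hflag'
    refine ⟨0, hm0, .inl ⟨hflag', ?_⟩⟩
    rintro ⟨y, rfl⟩
    exact hok (hx.readOk (by omega))

/-- Read an instance without applications. -/
def startRead : Prog :=
  setN rVars (.get 0 (.const 0)) ;; setN rStart (.const 1) ;; setN rEnd (.const 1) ;;
  .ite (.natLe (.const 1) (.natLen 0)) (setN rFlag (.const 1)) (setN rFlag (.const 0))

theorem runs_startRead : Runs B startRead (State.init w) fun s =>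
    s.Reading w (w.nats.getD 0 0) 1 0 ∧ s.natReg rFlag = flag (1 ≤ w.nats.length) := by
  refine runs_instr_seq (runs_instr_seq (runs_instr_seq
    (runs_ite (fun h => runs_instr.2 ⟨?_, ?_⟩) fun h => runs_instr.2 ⟨?_, ?_⟩)))
  · constructor <;> simp [State.init]
  · rw [flag_of (by simpa [State.init, Test.Holds, Nat.one_le_iff_ne_zero] using h)]
    simp
  · constructor <;> simp [State.init]
  · rw [flag_of_not (by simpa [State.init, Test.Holds] using h)]
    simp

/-- Read applications until the naturals of the input are exhausted or an application is
rejected. -/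
def readLoop (c : Prog) : Prog :=
  .loop (.and (.eq (.reg rFlag) (.const 1)) (.lt (.reg rEnd) (.natLen 0))) (readNext c)

theorem bound_readNext_le (c : Prog) : (readNext c).bound ≤ 30 + c.bound + 1 := by
  have hle {d : Prog} (hd : d.bound ≤ 31) : d.bound ≤ 30 + c.bound + 1 := hd.trans (by omega)
  have hset : (setN rFlag (.const 0)).bound ≤ 30 + c.bound + 1 := hle (by decide)
  have hrecognize : (recognize c).bound ≤ 30 + c.bound + 1 := by
    simp only [recognize, Prog.bound, bound_cleanProg, Prog.bound_shift, max_le_iff]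
    exact ⟨le_rfl, hle (by decide), Nat.le_succ _, hle (by decide), hset⟩
  exact max_le (hle (by decide)) (max_le (max_le (max_le (hle (by decide))
    (max_le hrecognize (hle (by decide)))) (hle (by decide))) hset)

theorem runs_readLoop (hc : c.Decides (Constraint.enc '' F) T)
    (hcl : Clean (30 + c.bound + 1) s) (h0 : ReadInv F w (w.nats.length - 1) s)
    (hB : w.size + 1 ≤ B) (hT : ∀ v : Word, v.size ≤ w.size → T v ≤ B) :
    Runs B (readLoop c) s fun s' => ∃ p, s'.natReg rFlag = flag p ∧
      (w ∈ Set.range (CSPInstance.enc (F := F)) ↔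
        p ∧ s'.natReg rNewTab = (s'.realArr 0).length) := by
  have hN : w.nats.length - 1 ≤ B := by
    rw [Word.size] at hB
    omega
  refine runs_loop hN (ReadInv F w) h0 (fun m s' hf hInv hb => ?_) fun m s' _ hInv hb => ?_
  all_goals rw [Test.Holds, Test.holds_eq, Test.holds_lt, NatExp.eval, NatExp.eval,
    NatExp.eval, NatExp.eval] at hb
  · obtain ⟨hflag, -⟩ | ⟨hflag, x, hx, hR, hm⟩ := hInv
    · exact absurd (hflag.symm.trans hb.1) zero_ne_one
    · rw [hR.pos, hR.nats] at hb
      exact runs_readNext_readInv hc (hcl.frame hf (bound_readNext_le c)) hflag hx hR hm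
        (by omega) hB hT
  · obtain ⟨hflag, hw⟩ | ⟨hflag, x, hx, hR, hm⟩ := hInv
    · exact ⟨False, hflag.trans (flag_of_not id).symm, by simp only [hw, false_and]⟩
    · rw [hR.pos, hR.nats] at hb
      refine ⟨True, hflag.trans (flag_of trivial).symm, ?_⟩
      rw [hx.mem_range_enc_iff (by omega), hR.tab, hR.reals, true_and, eq_comm]

/-- Decide whether the input encodes an instance, where the program `c` recognizes the
constraints. -/
def instanceProg (c : Prog) : Prog :=
  startRead ;; readLoop c ;;
    .ite (.eq (.reg rNewTab) (.realLen 0)) skip (setN rFlag (.const 0)) ;; answer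

theorem runs_instanceProg (hc : c.Decides (Constraint.enc '' F) T) (hB : w.size + 1 ≤ B)
    (hT : ∀ v : Word, v.size ≤ w.size → T v ≤ B) :
    Runs B (instanceProg c) (State.init w) fun s =>
      (w ∈ Set.range (CSPInstance.enc (F := F)) → s.output = Word.yes) ∧
      (w ∉ Set.range (CSPInstance.enc (F := F)) → s.output = Word.no) := by
  refine runs_startRead.seq fun s1 hf1 ⟨hR, hflag⟩ => ?_
  have hcl : Clean (30 + c.bound + 1) s1 := (clean_init w (by omega)).frame hf1
    ((by decide : startRead.bound ≤ 30).trans (by omega))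
  refine (runs_readLoop hc hcl (readInv_init hR hflag) hB hT).seq
    fun s2 _ ⟨p, hp, hiff⟩ => Runs.seq (runs_ite (fun h => runs_skip ?_) fun h => runs_instr.2 ?_)
      fun s3 _ h3 => runs_answer h3
  all_goals simp only [Test.holds_eq, NatExp.eval] at h
  · simpa only [hiff, h, and_true] using hp
  · simp [hiff, h, flag_of_not]

end RealRAM

/-! ## Finite sets of constraints -/

namespace RealRAM

/-- The set of inputs on which the test holds. -/
def Test.words (b : Test) : Set Word := {w | b.Holds (State.init w)}

theorem Test.exists_holds_iff_forall_lt (n : ℕ) (b : ℕ → Test) :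
    ∃ c : Test, ∀ s, c.Holds s ↔ ∀ i < n, (b i).Holds s := by
  induction n with
  | zero => exact ⟨.natLe (.const 0) (.const 0), by simp [Test.Holds]⟩
  | succ n ih =>
    obtain ⟨c, hc⟩ := ih
    exact ⟨.and c (b n), fun s => by rw [Test.Holds, hc, Nat.forall_lt_succ_right]⟩

theorem list_eq_iff_getD {α : Type*} {l m : List α} (d : α) :
    l = m ↔ l.length = m.length ∧ ∀ i < m.length, l.getD i d = m.getD i d := by
  refine ⟨fun h => h ▸ ⟨rfl, fun _ _ => rfl⟩, fun ⟨h, h'⟩ => List.ext_getElem h fun i h1 h2 => ?_⟩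
  simpa only [List.getD_eq_getElem _ _ h1, List.getD_eq_getElem _ _ h2] using h' i h2

theorem Test.exists_words_eq_singleton (v : Word) : ∃ b : Test, b.words = {v} := by
  obtain ⟨b, hb⟩ := Test.exists_holds_iff_forall_lt v.nats.length fun i =>
    .eq (.get 0 (.const i)) (.const (v.nats.getD i 0))
  obtain ⟨c, hc⟩ := Test.exists_holds_iff_forall_lt v.reals.length fun i =>
    .realEq (.get 0 (.const i)) (.const (v.reals.getD i 0))
  refine ⟨.and (.and (.eq (.natLen 0) (.const v.nats.length)) b)
    (.and (.eq (.realLen 0) (.const v.reals.length)) c), Set.ext fun ⟨N, R⟩ => ?_⟩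
  obtain ⟨N', R'⟩ := v
  simp only [Test.holds_eq, Test.holds_realEq, NatExp.eval, RealExp.eval] at hb hc
  simp only [Test.words, Set.mem_ofPred_eq, Set.mem_singleton_iff, Word.mk.injEq,
    list_eq_iff_getD (0 : ℕ), list_eq_iff_getD (0 : ℝ)]
  exact and_congr (and_congr (Test.holds_eq _ _) (hb _)) (and_congr (Test.holds_eq _ _) (hc _))

theorem Test.exists_words_eq_union (b c : Test) : ∃ d : Test, d.words = b.words ∪ c.words :=
  ⟨.not (.and (.not b) (.not c)), Set.ext fun w => by
    simp only [Test.words, Test.Holds, Set.mem_ofPred_eq, Set.mem_union]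
    tauto⟩

theorem Test.exists_words_eq_of_finite {S : Set Word} (hS : S.Finite) :
    ∃ b : Test, b.words = S := by
  induction S, hS using Set.Finite.induction_on with
  | empty => exact ⟨.natLe (.const 1) (.const 0), by simp [Test.words, Test.Holds]⟩
  | @insert v S _ _ ih =>
    obtain ⟨b, rfl⟩ := ih
    obtain ⟨c, hc⟩ := Test.exists_words_eq_singleton v
    obtain ⟨d, hd⟩ := Test.exists_words_eq_union c b
    exact ⟨d, by rw [hd, hc, Set.insert_eq]⟩

theorem Test.polyDecidableOn_words (b : Test) : PolyDecidableOn Set.univ b.words := by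
  let c : Prog := .ite b (setN rFlag (.const 1)) (setN rFlag (.const 0)) ;; answer
  obtain ⟨p, hp⟩ := c.exists_cost_poly
  have h : ∀ w, Runs w.size c (State.init w) fun s =>
      (w ∈ b.words → s.output = Word.yes) ∧ (w ∉ b.words → s.output = Word.no) := fun w =>
    Runs.seq (P := fun s => s.natReg rFlag = flag (w ∈ b.words))
      (runs_ite (fun h => runs_instr.2 (by simp [flag_of (show w ∈ b.words from h)]))
        fun h => runs_instr.2 (by simp [flag_of_not (show w ∉ b.words from h)]))
      fun s _ h => runs_answer h
  exact ⟨c, p, fun w _ => ⟨fun hw => ((h w).imp fun _ _ h' => h'.1 hw).yields (hp _).ge,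
    fun hw => ((h w).imp fun _ _ h' => h'.2 hw).yields (hp _).ge⟩⟩

end RealRAM

namespace Constraint

open RealRAM

theorem mem_enc_image_unary {w : Word} :
    w ∈ enc '' unary ↔ ∃ x y : ℝ, 0 ≤ x ∧ 0 ≤ y ∧ w = ⟨[1], [x, y]⟩ := by
  constructor
  · rintro ⟨⟨k, f⟩, hk, rfl⟩
    obtain rfl : k = 1 := hk
    exact ⟨_, _, NNReal.coe_nonneg _, NNReal.coe_nonneg _, rfl⟩
  · rintro ⟨x, y, hx, hy, rfl⟩
    refine ⟨⟨1, fun z => if z 0 then y.toNNReal else x.toNNReal⟩, rfl, ?_⟩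
    simp [enc, table, lexTuple, List.ofFn_succ, hx, hy]

theorem exists_words_eq_enc_image_unary : ∃ b : Test, b.words = enc '' unary := by
  refine ⟨.and (.and (.eq (.natLen 0) (.const 1)) (.eq (.get 0 (.const 0)) (.const 1)))
    (.and (.eq (.realLen 0) (.const 2)) (.and (.realLe (.const 0) (.get 0 (.const 0)))
      (.realLe (.const 0) (.get 0 (.const 1))))), Set.ext fun w => ?_⟩
  obtain ⟨l, m⟩ := w
  rw [mem_enc_image_unary, Test.words, Set.mem_ofPred_eq]
  simp only [Test.Holds, NatExp.eval, RealExp.eval, State.init, if_true, Word.mk.injEq]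
  constructor
  · rintro ⟨⟨h1, h2⟩, h3, h4, h5⟩
    obtain ⟨a, rfl⟩ := List.length_eq_one_iff.1 (le_antisymm h1.1 h1.2)
    obtain ⟨x, y, rfl⟩ := List.length_eq_two.1 (le_antisymm h3.1 h3.2)
    obtain rfl : a = 1 := le_antisymm h2.1 h2.2
    exact ⟨x, y, h4, h5, rfl, rfl⟩
  · rintro ⟨x, y, hx, hy, rfl, rfl⟩
    exact ⟨⟨⟨le_rfl, le_rfl⟩, le_rfl, le_rfl⟩, ⟨le_rfl, le_rfl⟩, hx, hy⟩

theorem recognizable_union_unary {F : Set Constraint} (hF : F.Finite) :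
    Recognizable (F ∪ unary) := by
  obtain ⟨b, hb⟩ := Test.exists_words_eq_of_finite (hF.image enc)
  obtain ⟨c, hc⟩ := exists_words_eq_enc_image_unary
  obtain ⟨d, hd⟩ := Test.exists_words_eq_union b c
  rw [Recognizable, Set.image_union, ← hb, ← hc, ← hd]
  exact d.polyDecidableOn_words

end Constraint

section Problem

open RealRAM

theorem monotone_eval_nat (p : Polynomial ℕ) : Monotone fun n => p.eval n := by
  intro m n h
  simp only [Polynomial.eval_eq_sum, Polynomial.sum]
  gcongr

theorem maxProdCSP_instancesRecognizable {F : Set Constraint} (hF : Constraint.Recognizable F) :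
    (maxProdCSP F).InstancesRecognizable := by
  obtain ⟨c, q, hq⟩ := hF
  obtain ⟨p, hp⟩ := (instanceProg c).exists_poly_comp_cost (Polynomial.X + 1 + q)
  refine ⟨instanceProg c, p, fun w _ => ?_⟩
  have h := runs_instanceProg (w := w) (B := (Polynomial.X + 1 + q).eval w.size)
    (T := fun v => q.eval v.size) (fun v => hq v trivial) (by simp)
    fun v hv => (monotone_eval_nat q hv).trans (by simp)
  exact ⟨fun hw => (h.imp fun _ _ h' => h'.1 hw).yields (hp _).ge,
    fun hw => (h.imp fun _ _ h' => h'.2 hw).yields (hp _).ge⟩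

end Problem

end

theorem mainTheorem3 (F : Set Constraint)
    (hF : F ⊆ Constraint.AF ∨ F ⊆ Constraint.ED) :
    ((maxProdCSPStar F).SolutionsRecognizable ∧ (maxProdCSPStar F).SolutionsBounded ∧
      (maxProdCSPStar F).MeasureComputable ∧ (maxProdCSPStar F).OptimumComputable) ∧
    (F.Finite ∨ Constraint.Recognizable (F ∪ Constraint.unary) → (maxProdCSPStar F).InPO) := by
  have hED : F ∪ Constraint.unary ⊆ Constraint.ED :=
    Set.union_subset (hF.elim (fun h => h.trans Constraint.AF_subset_ED) id)
      Constraint.unary_subset_ED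
  have hsol := maxProdCSP_solutionsRecognizable (F ∪ Constraint.unary)
  have hbdd := maxProdCSP_solutionsBounded (F ∪ Constraint.unary)
  have hmeas := maxProdCSP_measureComputable (F ∪ Constraint.unary)
  have hopt := maxProdCSP_optimumComputable hED
  exact ⟨⟨hsol, hbdd, hmeas, hopt⟩, fun h =>
    ⟨⟨maxProdCSP_instancesRecognizable (h.elim Constraint.recognizable_union_unary id),
      hsol, hbdd, hmeas⟩, hopt⟩⟩
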